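/- All topological groups are $T_1$ (hence completely regular). A space is Fréchet if every point of the closure of a set $A$ is the limit of a sequence in $A$, and sequential if every set that contains the limits of all convergent sequences of its points is closed. A space $Y$ is $k_\omega$ (respectively $c_\omega$) if there is a countable family $\mathcal K$ of compact (respectively countably compact) subspaces of $Y$ such that $U\subseteq Y$ is open if and only if $U\cap K$ is relatively open in $K$ for every $K\in\mathcal K$. The tower number $\mathfrak t$ is the least cardinality of a sequence of infinite subsets of $\mathbb N$, indexed by an ordinal and decreasing modulo finite sets, that has no infinite pseudointersection. A $\gamma\mathbb N$ space is a locally compact Hausdorff space whose set of isolated points is countable and dense and whose subspace of non-isolated points is homeomorphic to $\omega_1$ with the order topology. The free Boolean topological group over a space $K$ is the group of finite subsets of $K$ under symmetric difference, with the finest group topology for which $x\mapsto\{x\}$ is continuous. (1) If there is no separable non-metrizable Fréchet group, then there is a separable sequential $c_\omega$ topological group that is not $k_\omega$. (2) If there is no separable non-metrizable Fréchet group, then $\mathfrak t=\omega_1$. (3) If $\mathfrak t=\omega_1$, then there is a countably compact $\gamma\mathbb N$ space $X$ such that the subgroup generated by $X$ in the free Boolean topological group over the one-point compactification of $X$, with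 the subspace topology, is a separable sequential $c_\omega$ group that is not $k_\omega$. -/

import Mathlib

open Set Topology

/-- A `k_ω`-space: the topology is determined by a countable family of compact subspaces. -/
def IsKOmegaSpace (X : Type*) [TopologicalSpace X] : Prop :=
  ∃ 𝒦 : Set (Set X), 𝒦.Countable ∧ (∀ K ∈ 𝒦, IsCompact K) ∧
    ∀ U : Set X, IsOpen U ↔ ∀ K ∈ 𝒦, IsOpen ((↑) ⁻¹' U : Set K)

/-- A `c_ω`-space: the topology is determined by a countable family of countably compact
subspaces. -/
def IsCOmegaSpace (X : Type*) [TopologicalSpace X] : Prop :=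
  ∃ 𝒦 : Set (Set X), 𝒦.Countable ∧ (∀ K ∈ 𝒦, IsCountablyCompact K) ∧
    ∀ U : Set X, IsOpen U ↔ ∀ K ∈ 𝒦, IsOpen ((↑) ⁻¹' U : Set K)

/-- A tower of length `α`: an `α`-sequence of infinite sets of natural numbers, decreasing modulo
finite sets, which has no infinite pseudointersection. -/
structure IsTower (α : Ordinal.{0}) (T : α.ToType → Set ℕ) : Prop where
  infinite : ∀ i, (T i).Infinite
  decreasing : ∀ i j, i < j → (T j \ T i).Finite
  no_pseudointersection : ¬ ∃ P : Set ℕ, P.Infinite ∧ ∀ i, (P \ T i).Finite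

/-- The tower number `𝔱`: the least cardinality of (the index set of) a tower. -/
noncomputable def towerNumber : Cardinal.{0} :=
  sInf {κ | ∃ (α : Ordinal.{0}) (T : α.ToType → Set ℕ), IsTower α T ∧ α.card = κ}

/-- A `γℕ` space: a locally compact Hausdorff space whose set of isolated points is countable and
dense, and in which the set of non-isolated points is homeomorphic to `ω₁` with its order
topology. (The set of isolated points is then automatically infinite.) -/
structure IsGammaN (X : Type*) [TopologicalSpace X] : Prop where
  t2 : T2Space X
  locallyCompact : LocallyCompactSpace X
  countable_isolated : {x : X | IsOpen {x}}.Countable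
  dense_isolated : Dense {x : X | IsOpen {x}}
  remainder : Nonempty ({x : X | ¬ IsOpen {x}} ≃ₜ Set.Iio (Ordinal.omega.{0} 1))

/-- The free Boolean group over `K`: the vector space over `ℤ/2` with basis `K`, that is, the
finite subsets of `K` under symmetric difference. -/
def FreeBooleanGroup (K : Type*) : Type _ := K →₀ ZMod 2

namespace FreeBooleanGroup

noncomputable instance (K : Type*) : AddCommGroup (FreeBooleanGroup K) :=
  inferInstanceAs (AddCommGroup (K →₀ ZMod 2))

/-- The canonical map of `K` to the free Boolean group over `K`. -/
noncomputable def of {K : Type*} (x : K) : FreeBooleanGroup K := Finsupp.single x 1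

/-- The topology of the free Boolean topological group over the space `K`: the finest group
topology for which the canonical map is continuous. -/
noncomputable def groupTopology (K : Type*) [TopologicalSpace K] :
    AddGroupTopology (FreeBooleanGroup K) :=
  AddGroupTopology.coinduced (of : K → FreeBooleanGroup K)

noncomputable instance (K : Type*) [TopologicalSpace K] :
    TopologicalSpace (FreeBooleanGroup K) :=
  (groupTopology K).toTopologicalSpace

instance (K : Type*) [TopologicalSpace K] : IsTopologicalAddGroup (FreeBooleanGroup K) :=
  (groupTopology K).toIsTopologicalAddGroup

theorem continuous_of (K : Type*) [TopologicalSpace K] :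
    Continuous (of : K → FreeBooleanGroup K) :=
  AddGroupTopology.coinduced_continuous _

end FreeBooleanGroup

/-- The subgroup generated by `X` in the free Boolean topological group over the one-point
compactification of `X`; it carries the subspace topology. -/
noncomputable def booleanSubgroup (X : Type*) [TopologicalSpace X] :
    AddSubgroup (FreeBooleanGroup (OnePoint X)) :=
  AddSubgroup.closure (Set.range fun x : X => FreeBooleanGroup.of (x : OnePoint X))

/-- There is a separable non-metrizable Fréchet topological group (topological groups are `T₁` and
completely regular). -/
def ExistsSeparableNonmetrizableFrechetGroup : Prop :=
  ∃ (G : Type) (_ : Group G) (_ : TopologicalSpace G), IsTopologicalGroup G ∧ T35Space G ∧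
    TopologicalSpace.SeparableSpace G ∧ FrechetUrysohnSpace G ∧
    ¬ TopologicalSpace.MetrizableSpace G

/-! Part (1) is (2) followed by (3), so there are two arguments.

For (2), suppose `𝔱 ≠ ℵ₁`. Then there is no tower of length `ω₁`, hence any `ℵ₁` functions are
bounded modulo finite sets, and Rothberger's argument upgrades this to pseudointersections of all
centred families of size `ℵ₁`. So countable subspaces of `Y ^ ω₁`, `Y` discrete, are Fréchet. A
countable subgroup of `{±1} ^ ω₁` that separates the coordinates is then a Fréchet group that is not
first countable.

For (3), a tower of size `ℵ₁` yields a chain `A w`, `w < ω₁`, strictly increasing modulo finite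
sets, such that every infinite set meets some `A w` in an infinite set. It topologizes `X = ℕ ⊔ ω₁`
as a first countable, countably compact, non-compact space. Let `K = X ∪ {∞}`. The group over the
compact space `K` has the topology determined by the powers `K ^ n`
(`isOpen_of_forall_isOpen_tupleSum`). The crux is that the subgroup generated by `X` has the
topology determined by the powers `X ^ n`. If `U` has open traces on these, let `V` be the set of
`a` such that substituting `w` for `∞` in `a` gives an element of `U` for all large `w`. A
closing-off argument in `ω₁` (`frequently_retract_mem`) shows that `V` has open traces on all `K ^
n`, and `V` meets the subgroup in `U`. Sequentiality and the `c_ω` property now come from `X ^ n`. A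
compact subset of the subgroup contains only boundedly many of the ordinals, because `∞` is not in
the subgroup; so countably many compact sets miss some ordinal, and they would make it isolated. -/

/-! ### Countable ordinals and transfinite recursion -/

/-- The well-ordered set of countable ordinals, as a type in the lowest universe. -/
abbrev CountableOrdinal : Type := (Ordinal.omega.{0} 1).ToType

namespace CountableOrdinal

theorem mk_eq : Cardinal.mk CountableOrdinal = Cardinal.aleph 1 := by
  rw [Cardinal.mk_toType, ← Cardinal.ord_aleph, Cardinal.card_ord]

instance : Uncountable CountableOrdinal := by
  rw [← Cardinal.aleph0_lt_mk_iff, mk_eq]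
  exact Cardinal.aleph0_lt_aleph_one

theorem countable_Iio (w : CountableOrdinal) : (Iio w).Countable := by
  rw [← Cardinal.le_aleph0_iff_set_countable, ← Order.lt_succ_iff, Cardinal.succ_aleph0]
  have h := Ordinal.typein_lt_self w
  have h2 : (Ordinal.typein (α := CountableOrdinal) (· < ·) w).card < Cardinal.aleph 1 := by
    rwa [← Cardinal.lt_ord, Cardinal.ord_aleph]
  exact h2

theorem countable_Iic (w : CountableOrdinal) : (Iic w).Countable := by
  rw [← Iio_insert]
  exact (countable_Iio w).insert w

theorem exists_forall_lt {S : Set CountableOrdinal} (hS : S.Countable) :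
    ∃ w, ∀ s ∈ S, s < w := by
  by_contra! h
  refine Set.not_countable_univ (α := CountableOrdinal) ?_
  refine (hS.biUnion fun s _ => countable_Iic s).mono fun w _ => ?_
  obtain ⟨s, hs, hw⟩ := h w
  exact mem_biUnion hs hw

instance : NoMaxOrder CountableOrdinal where
  exists_gt a := by
    obtain ⟨w, hw⟩ := exists_forall_lt (countable_singleton a)
    exact ⟨w, hw a rfl⟩

instance : Nonempty CountableOrdinal := by
  obtain ⟨w, -⟩ := exists_forall_lt countable_empty
  exact ⟨w⟩

end CountableOrdinal

/-- Transfinite construction of a function whose values satisfy a unary condition, and whose pairs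
of values satisfy a binary one. -/
theorem exists_transfinite_construction {ι β : Type*} [LinearOrder ι] [WellFoundedLT ι]
    [Nonempty β]
    (Q : ι → β → Prop) (R : β → β → Prop)
    (step : ∀ (w : ι) (F : ι → β), (∀ v < w, Q v (F v) ∧ ∀ u < v, R (F u) (F v)) →
      ∃ b, Q w b ∧ ∀ v < w, R (F v) b) :
    ∃ F : ι → β, (∀ w, Q w (F w)) ∧ ∀ v w, v < w → R (F v) (F w) := by
  classical
  -- An unconditional choice makes the recursion total; that its values satisfy the conditions is
  -- checked afterwards by induction.
  let next : (w : ι) → ((v : ι) → v < w → β) → β := fun w f =>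
    Classical.epsilon fun b => Q w b ∧ ∀ v (h : v < w), R (f v h) b
  let F : ι → β := (wellFounded_lt (α := ι)).fix next
  have hF : ∀ w, F w = Classical.epsilon fun b => Q w b ∧ ∀ v < w, R (F v) b := fun w =>
    (wellFounded_lt (α := ι)).fix_eq next w
  have key : ∀ w, Q w (F w) ∧ ∀ v < w, R (F v) (F w) := by
    intro w
    induction w using WellFoundedLT.induction with
    | ind w ih =>
      rw [hF w]
      exact Classical.epsilon_spec (step w F ih)
  exact ⟨F, fun w => (key w).1, fun v w h => (key w).2 v h⟩

/-! ### Pseudointersections and towers -/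

-- The filter generated by the `D i` and the cofinite sets is proper and countably generated, so
-- some sequence tends to it; its range is `P`.
open Filter in
theorem exists_infinite_pseudointersection {κ : Type*} [Countable κ] (D : κ → Set ℕ)
    (hD : ∀ F : Finset κ, (⋂ i ∈ F, D i).Infinite) :
    ∃ P : Set ℕ, P.Infinite ∧ ∀ i, (P \ D i).Finite := by
  have hne : ((⨅ i, 𝓟 (D i)) ⊓ atTop).NeBot := by
    rw [inf_neBot_iff_frequently_left, ← Nat.cofinite_eq_atTop]
    intro p hp
    obtain ⟨t, ht, hsub⟩ := (hasBasis_iInf_principal_finite D).mem_iff.1 hp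
    rw [frequently_cofinite_iff_infinite]
    refine (hD ht.toFinset).mono fun n hn => hsub ?_
    simpa using hn
  obtain ⟨u, hu⟩ := ((⨅ i, 𝓟 (D i)) ⊓ atTop).exists_seq_tendsto
  rw [inf_comm, tendsto_inf, tendsto_iInf, ← Nat.cofinite_eq_atTop] at hu
  have hev : ∀ i, ∀ᶠ k in cofinite, u k ∈ D i := fun i => tendsto_principal.1 (hu.2 i)
  refine ⟨range u, fun hfin => ?_, fun i => ?_⟩
  · have := hu.1.eventually (hfin.compl_mem_cofinite)
    obtain ⟨k, hk⟩ := this.exists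
    exact hk ⟨k, rfl⟩
  · have := hev i
    rw [eventually_cofinite] at this
    refine (this.image u).subset ?_
    rintro _ ⟨⟨k, rfl⟩, hk⟩
    exact ⟨k, hk, rfl⟩

theorem finite_diff_biInter {J : Type*} [LinearOrder J] {T : J → Set ℕ}
    (hdec : ∀ i j, i < j → (T j \ T i).Finite) (F : Finset J) (j : J) (hj : ∀ i ∈ F, i ≤ j) :
    (T j \ ⋂ i ∈ F, T i).Finite := by
  have : T j \ ⋂ i ∈ F, T i = ⋃ i ∈ F, T j \ T i := by
    ext n; simp
  rw [this]
  refine F.finite_toSet.biUnion fun i hi => ?_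
  rcases (hj i hi).eq_or_lt with rfl | h
  · simp
  · exact hdec i j h

/-- In a family decreasing modulo finite sets, finite intersections of infinite sets
are infinite. -/
theorem infinite_biInter {J : Type*} [LinearOrder J] {T : J → Set ℕ}
    (hinf : ∀ i, (T i).Infinite) (hdec : ∀ i j, i < j → (T j \ T i).Finite) (F : Finset J) :
    (⋂ i ∈ F, T i).Infinite := by
  rcases F.eq_empty_or_nonempty with rfl | hF
  · simpa using infinite_univ
  · have := finite_diff_biInter hdec F (F.max' hF) fun i hi => F.le_max' i hi
    intro hfin
    refine hinf (F.max' hF) ((hfin.union this).subset fun n hn => ?_)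
    by_cases h : n ∈ ⋂ i ∈ F, T i
    · exact Or.inl h
    · exact Or.inr ⟨hn, h⟩

/-- A countable set of indices of a tower is bounded. -/
theorem IsTower.exists_forall_lt {α : Ordinal.{0}} {T : α.ToType → Set ℕ} (hT : IsTower α T)
    {S : Set α.ToType} (hS : S.Countable) :
    ∃ j, ∀ s ∈ S, s < j ∧ (T s \ T j).Infinite := by
  -- Otherwise `T s` is itself a pseudointersection.
  have hnext : ∀ s, ∃ j, s < j ∧ (T s \ T j).Infinite := by
    intro s
    by_contra! h
    refine hT.no_pseudointersection ⟨T s, hT.infinite s, fun i => ?_⟩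
    rcases lt_trichotomy s i with hi | rfl | hi
    · exact h i hi
    · simp
    · exact hT.decreasing i s hi
  choose nx hnx using hnext
  -- If the `nx s` were cofinal, a pseudointersection of these countably many sets would be one for
  -- the whole tower.
  have : ∃ j, ∀ s ∈ S, nx s < j := by
    by_contra! h
    have := hS.to_subtype
    obtain ⟨P, hP, hPS⟩ := exists_infinite_pseudointersection (fun s : S => T (nx s))
      (fun F => by
        have := infinite_biInter hT.infinite hT.decreasing (F.image fun s : S => nx s)
        simpa using this)
    refine hT.no_pseudointersection ⟨P, hP, fun j => ?_⟩
    obtain ⟨s, hs, hj⟩ := h j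
    have h1 := hPS ⟨s, hs⟩
    have h2 : (T (nx s) \ T j).Finite := by
      rcases hj.eq_or_lt with h | h
      · simp [h]
      · exact hT.decreasing _ _ h
    refine (h1.union h2).subset fun n hn => ?_
    by_cases h : n ∈ T (nx s)
    · exact Or.inr ⟨h, hn.2⟩
    · exact Or.inl ⟨hn.1, h⟩
  obtain ⟨j, hj⟩ := this
  refine ⟨j, fun s hs => ⟨(hnx s).1.trans (hj s hs), fun hfin => (hnx s).2 ?_⟩⟩
  refine (hfin.union (hT.decreasing _ _ (hj s hs))).subset fun n hn => ?_
  by_cases h : n ∈ T j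
  · exact Or.inr ⟨h, hn.2⟩
  · exact Or.inl ⟨hn.1, h⟩

theorem IsTower.aleph_one_le_card {α : Ordinal.{0}} {T : α.ToType → Set ℕ} (hT : IsTower α T) :
    Cardinal.aleph 1 ≤ α.card := by
  by_contra! h
  have hc : (univ : Set α.ToType).Countable := by
    rw [← Cardinal.le_aleph0_iff_set_countable, ← Order.lt_succ_iff, Cardinal.succ_aleph0]
    simpa using h
  obtain ⟨j, hj⟩ := hT.exists_forall_lt hc
  exact lt_irrefl _ (hj j (mem_univ _)).1

/-- If `𝔱` is not `ℵ₁`, then there is no tower of length `ω₁`. -/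
theorem exists_pseudointersection_of_towerNumber_ne (h : towerNumber ≠ Cardinal.aleph 1)
    (T : CountableOrdinal → Set ℕ) (hinf : ∀ i, (T i).Infinite)
    (hdec : ∀ i j, i < j → (T j \ T i).Finite) :
    ∃ P : Set ℕ, P.Infinite ∧ ∀ i, (P \ T i).Finite := by
  by_contra hP
  refine h (le_antisymm (csInf_le' ⟨_, T, ⟨hinf, hdec, hP⟩, ?_⟩) ?_)
  · rw [← Cardinal.mk_toType, CountableOrdinal.mk_eq]
  · refine le_csInf ⟨_, _, T, ⟨hinf, hdec, hP⟩, rfl⟩ ?_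
    rintro κ ⟨α, T', hT', rfl⟩
    exact hT'.aleph_one_le_card

/-- If `𝔱` is `ℵ₁`, there is a sequence of length `ω₁` of sets of natural numbers, strictly
increasing modulo finite sets, such that every infinite set has infinite intersection with one of
them. -/
theorem exists_increasing_of_towerNumber_eq (h : towerNumber = Cardinal.aleph 1) :
    ∃ A : CountableOrdinal → Set ℕ, (∀ w, (A w).Infinite) ∧
      (∀ v w, v < w → (A v \ A w).Finite ∧ (A w \ A v).Infinite) ∧
      ∀ P : Set ℕ, P.Infinite → ∃ w, (P ∩ A w).Infinite := by
  -- The infimum of the empty set is `0`, so `h` guarantees that a tower exists.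
  have hne : {κ | ∃ (α : Ordinal.{0}) (T : α.ToType → Set ℕ), IsTower α T ∧ α.card = κ}.Nonempty := by
    by_contra hne
    rw [not_nonempty_iff_eq_empty] at hne
    rw [towerNumber, hne, Cardinal.sInf_empty] at h
    exact (Cardinal.aleph_pos 1).ne h
  obtain ⟨α, T, hT, hα⟩ := csInf_mem hne
  change α.card = towerNumber at hα
  rw [h, ← Cardinal.mk_toType, ← CountableOrdinal.mk_eq] at hα
  obtain ⟨e⟩ := Cardinal.eq.1 hα
  have : Nonempty α.ToType := e.nonempty
  -- Passing beyond `e.symm w` at stage `w` makes `g` cofinal in the tower and the complement of `T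
  -- (g w)` infinite.
  obtain ⟨g, hg, hg2⟩ := exists_transfinite_construction (ι := CountableOrdinal)
    (fun w j => e.symm w < j ∧ (T (e.symm w) \ T j).Infinite)
    (fun i j => i < j ∧ (T i \ T j).Infinite) (fun w F _ => by
      obtain ⟨j, hj⟩ := hT.exists_forall_lt
        (((CountableOrdinal.countable_Iio w).image F).insert (e.symm w))
      exact ⟨j, hj _ (mem_insert _ _), fun v hv => hj _ (mem_insert_of_mem _ ⟨v, hv, rfl⟩)⟩)
  refine ⟨fun w => (T (g w))ᶜ, fun w => (hg w).2.mono fun n hn => hn.2, fun v w hvw => ⟨?_, ?_⟩,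
    fun P hP => ?_⟩
  · refine (hT.decreasing _ _ (hg2 v w hvw).1).subset fun n hn => ⟨not_not.1 hn.2, hn.1⟩
  · refine (hg2 v w hvw).2.mono fun n hn => ⟨hn.2, not_not.2 hn.1⟩
  · by_contra! hcon
    refine hT.no_pseudointersection ⟨P, hP, fun i => ?_⟩
    have h1 := hcon (e i)
    have h2 := hT.decreasing _ _ (hg (e i)).1
    rw [e.symm_apply_apply] at h2
    refine (h1.union h2).subset fun n hn => ?_
    by_cases hn' : n ∈ T (g (e i))
    · exact Or.inr ⟨hn', hn.2⟩
    · exact Or.inl ⟨hn.1, hn'⟩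

/-! ### Without towers of length `ω₁`: a separable non-metrizable Fréchet group -/

/-- Every sequence of length `ω₁` of infinite sets of natural numbers which decreases modulo finite
sets has an infinite pseudointersection. -/
def NoTowerOfLengthOmegaOne : Prop :=
  ∀ T : CountableOrdinal → Set ℕ, (∀ i, (T i).Infinite) → (∀ i j, i < j → (T j \ T i).Finite) →
    ∃ P : Set ℕ, P.Infinite ∧ ∀ i, (P \ T i).Finite

/-- Sparse sets encode growth: the next-element function of `T` bounds `f` on `T`. -/
theorem exists_infinite_sparse_subset {P : Set ℕ} (hP : P.Infinite) {f : ℕ → ℕ} (hf : Monotone f) :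
    ∃ T ⊆ P, T.Infinite ∧ ∀ a ∈ T, ∀ b ∈ T, a < b → f a ≤ b := by
  have hnext : ∀ n, ∃ m ∈ P, max n (f n) < m := fun n => hP.exists_gt _
  choose nx hnx using hnext
  let t : ℕ → ℕ := fun k => nx^[k + 1] 0
  have ht : ∀ k, t (k + 1) = nx (t k) := fun k => Function.iterate_succ_apply' nx (k + 1) 0
  have hmono : StrictMono t := strictMono_nat_of_lt_succ fun k => by
    rw [ht]; exact (le_max_left _ _).trans_lt (hnx _).2
  refine ⟨range t, ?_, infinite_range_of_injective hmono.injective, ?_⟩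
  · rintro _ ⟨k, rfl⟩
    change nx^[k + 1] 0 ∈ P
    rw [Function.iterate_succ_apply']
    exact (hnx _).1
  · rintro _ ⟨i, rfl⟩ _ ⟨j, rfl⟩ hij
    have hlt : i < j := hmono.lt_iff_lt.1 hij
    obtain ⟨k, rfl⟩ : ∃ k, j = k + 1 := ⟨j - 1, by omega⟩
    rw [ht]
    exact (hf (hmono.monotone (by omega))).trans ((le_max_right _ _).trans_lt (hnx _).2).le

open Filter in
/-- If there are no towers of length `ω₁`, then any `ℵ₁` functions are bounded modulo finite
sets. -/
theorem NoTowerOfLengthOmegaOne.exists_eventually_le (h : NoTowerOfLengthOmegaOne)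
    (f : CountableOrdinal → ℕ → ℕ) : ∃ g : ℕ → ℕ, ∀ w, ∀ᶠ n in atTop, f w n ≤ g n := by
  -- Sparseness requires a monotone bound, hence `partialSups`.
  obtain ⟨T, hT, hdec⟩ := exists_transfinite_construction (ι := CountableOrdinal)
    (fun w (S : Set ℕ) => S.Infinite ∧ ∀ a ∈ S, ∀ b ∈ S, a < b → partialSups (f w) a ≤ b)
    (fun S S' => (S' \ S).Finite) (fun w F hF => by
      have := (CountableOrdinal.countable_Iio w).to_subtype
      obtain ⟨P, hP, hPF⟩ := exists_infinite_pseudointersection (fun v : Iio w => F v)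
        (infinite_biInter (fun v => (hF v v.2).1.1) fun u v huv => (hF v v.2).2 u huv)
      obtain ⟨S, hSP, hS, hS2⟩ := exists_infinite_sparse_subset hP (partialSups (f w)).monotone
      exact ⟨S, ⟨hS, hS2⟩, fun v hv => (hPF ⟨v, hv⟩).subset (sdiff_subset_sdiff_left hSP)⟩)
  obtain ⟨P, hP, hPT⟩ := h T (fun w => (hT w).1) hdec
  choose nx hnxP hnx using fun n => hP.exists_gt n
  -- Two steps are needed: `nx n` reaches `T w`, and the gap to the next point of `P`, also in `T
  -- w`, bounds `f w`.
  refine ⟨fun n => nx (nx n), fun w => ?_⟩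
  obtain ⟨N, hN⟩ := (hPT w).bddAbove
  filter_upwards [eventually_ge_atTop N] with n hn
  have hmem : ∀ m ∈ P, n < m → m ∈ T w := fun m hm hnm => by
    by_contra hcon
    exact absurd (hN ⟨hm, hcon⟩) (by omega)
  have h1 := hmem _ (hnxP n) (hnx n)
  have h2 := hmem _ (hnxP (nx n)) ((hnx n).trans (hnx _))
  exact (le_partialSups (f w) n).trans
    (((partialSups (f w)).monotone (hnx n).le).trans ((hT w).2 _ h1 _ h2 (hnx _)))

-- A diagonal argument: `f w n` is a point of `B w` beyond `n` in the intersection `E n` of the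
-- first `n + 1` sets. If `g` eventually bounds every `f w`, the union of the finite sets `E n ∩ [0,
-- g n]` contains almost all these points, and only its first few pieces can leave a given `D i`.
open Filter in
theorem NoTowerOfLengthOmegaOne.exists_pseudointersection_meeting (h : NoTowerOfLengthOmegaOne)
    {κ : Type*} [Countable κ] [Nonempty κ] (D : κ → Set ℕ)
    (B : CountableOrdinal → Set ℕ)
    (hDB : ∀ (F : Finset κ) w, ((⋂ i ∈ F, D i) ∩ B w).Infinite) :
    ∃ T : Set ℕ, (∀ i, (T \ D i).Finite) ∧ ∀ w, (T ∩ B w).Infinite := by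
  classical
  obtain ⟨e, he⟩ := exists_surjective_nat κ
  let E : ℕ → Set ℕ := fun n => ⋂ i ∈ (Finset.range (n + 1)).image e, D i
  choose f hf hfn using fun w n => (hDB ((Finset.range (n + 1)).image e) w).exists_gt n
  obtain ⟨g, hg⟩ := h.exists_eventually_le f
  refine ⟨⋃ n, E n ∩ Iic (g n), fun i => ?_, fun w => ?_⟩
  · obtain ⟨m, rfl⟩ := he i
    refine ((finite_Iio m).biUnion fun n _ => finite_Iic (g n)).subset ?_
    rintro k ⟨hk, hkD⟩
    obtain ⟨n, hn, hng⟩ := mem_iUnion.1 hk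
    refine mem_biUnion (show n ∈ Iio m from ?_) hng
    by_contra hnm
    refine hkD (mem_iInter₂.1 hn (e m) (Finset.mem_image_of_mem _ ?_))
    simp only [mem_Iio, not_lt] at hnm
    simpa using Nat.lt_succ_of_le hnm
  · obtain ⟨N, hN⟩ := eventually_atTop.1 (hg w)
    refine infinite_of_forall_exists_gt fun a => ?_
    refine ⟨f w (max a N), ⟨mem_iUnion.2 ⟨max a N, (hf w _).1, hN _ (le_max_right _ _)⟩,
      (hf w _).2⟩, (le_max_left _ _).trans_lt (hfn w _)⟩

/-- If there are no towers of length `ω₁`, then every centred family of `ℵ₁` sets of natural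
numbers has an infinite pseudointersection (Rothberger). -/
theorem NoTowerOfLengthOmegaOne.exists_pseudointersection (h : NoTowerOfLengthOmegaOne)
    (A : CountableOrdinal → Set ℕ) (hA : ∀ F : Finset CountableOrdinal, (⋂ i ∈ F, A i).Infinite) :
    ∃ P : Set ℕ, P.Infinite ∧ ∀ i, (P \ A i).Finite := by
  classical
  have hcard : Cardinal.mk (Finset CountableOrdinal) = Cardinal.mk CountableOrdinal :=
    Cardinal.mk_finset_of_infinite _
  obtain ⟨e⟩ := Cardinal.eq.1 hcard
  -- Requiring `S` to meet every finite intersection in an infinite set keeps the recursion going.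
  obtain ⟨T, hT, hdec⟩ := exists_transfinite_construction (ι := CountableOrdinal)
    (fun w (S : Set ℕ) => (S \ A w).Finite ∧
      ∀ F : Finset CountableOrdinal, (S ∩ ⋂ i ∈ F, A i).Infinite)
    (fun S S' => (S' \ S).Finite) (fun w F hF => by
      have := (CountableOrdinal.countable_Iio w).to_subtype
      obtain ⟨S, hS, hS2⟩ := h.exists_pseudointersection_meeting
        (fun v : Option (Iio w) => v.elim (A w) fun v => F v)
        (fun u => ⋂ i ∈ e.symm u, A i) (fun G u => by
          -- Finitely many earlier sets almost contain the last of them; `univ` serves when there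
          -- are none.
          have hG : ∃ X : Set ℕ, (∀ K : Finset CountableOrdinal, (X ∩ ⋂ i ∈ K, A i).Infinite) ∧
              (X \ ⋂ i ∈ G.eraseNone, F i).Finite := by
            rcases G.eraseNone.eq_empty_or_nonempty with hG | hG
            · refine ⟨univ, fun K => by simpa using hA K, by simp [hG]⟩
            · refine ⟨F (G.eraseNone.max' hG), (hF _ (G.eraseNone.max' hG).2).1.2, ?_⟩
              exact finite_diff_biInter (T := fun v : Iio w => F v)
                (fun u v huv => (hF v v.2).2 u huv) _ _ fun i hi => Finset.le_max' _ i hi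
          obtain ⟨X, hX, hX2⟩ := hG
          intro hfin
          refine hX (insert w (e.symm u)) ((hfin.union hX2).subset ?_)
          rintro n ⟨hn, hn2⟩
          by_cases hn3 : n ∈ ⋂ i ∈ G.eraseNone, F i
          · left
            simp only [Finset.mem_insert, iInter_iInter_eq_or_left, mem_inter_iff] at hn2
            refine ⟨mem_iInter₂.2 fun i hi => ?_, hn2.2⟩
            cases i with
            | none => exact hn2.1
            | some i => exact mem_iInter₂.1 hn3 i (Finset.mem_eraseNone.2 hi)
          · exact Or.inr ⟨hn, hn3⟩)
      exact ⟨S, ⟨hS none, fun F => by simpa using hS2 (e F)⟩, fun v hv => hS (some ⟨v, hv⟩)⟩)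
  obtain ⟨P, hP, hPT⟩ := h T (fun w => ((hT w).2 ∅).mono inter_subset_left) hdec
  refine ⟨P, hP, fun w => ((hPT w).union (hT w).1).subset fun n hn => ?_⟩
  by_cases hn' : n ∈ T w
  · exact Or.inr ⟨hn', hn.2⟩
  · exact Or.inl ⟨hn.1, hn'⟩

open Filter in
/-- If there are no towers of length `ω₁`, then countable subspaces of the power with exponent
`ω₁` of a discrete space are Fréchet. -/
theorem NoTowerOfLengthOmegaOne.frechetUrysohnSpace (h : NoTowerOfLengthOmegaOne)
    {Y : Type*} [TopologicalSpace Y] [DiscreteTopology Y] {G : Set (CountableOrdinal → Y)}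
    (hG : G.Countable) : FrechetUrysohnSpace G := by
  refine ⟨fun A x hx => ?_⟩
  by_cases hxA : x ∈ A
  · exact ⟨fun _ => x, fun _ => hxA, tendsto_const_nhds⟩
  have := hG.to_subtype
  obtain ⟨e, he⟩ := exists_injective_nat G
  let V : CountableOrdinal → Set G := fun w => {g | g.1 w = x.1 w}
  have hV : ∀ w, IsOpen (V w) := fun w =>
    (isOpen_discrete {x.1 w}).preimage
      (show Continuous fun g : G => g.1 w from (continuous_apply w).comp continuous_subtype_val)
  -- As `x` lies in the closure of `A` but not in `A`, every neighbourhood of `x` contains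
  -- infinitely many points of `A`, so the traces on `A` are centred. A pseudointersection
  -- enumerates a sequence converging in each coordinate.
  obtain ⟨P, hP, hPA⟩ := h.exists_pseudointersection (fun w => e '' (A ∩ V w)) fun F => by
    have hinf : (A ∩ ⋂ w ∈ F, V w).Infinite := fun hfin => by
      have hop : IsOpen ((⋂ w ∈ F, V w) ∩ (A ∩ ⋂ w ∈ F, V w)ᶜ) :=
        (isOpen_biInter_finset fun w _ => hV w).inter hfin.isClosed.isOpen_compl
      obtain ⟨y, ⟨hy, hy2⟩, hyA⟩ := mem_closure_iff.1 hx _ hop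
        ⟨mem_iInter₂.2 fun w _ => rfl, fun hcon => hxA hcon.1⟩
      exact hy2 ⟨hyA, hy⟩
    refine (hinf.image he.injOn).mono ?_
    rintro _ ⟨y, ⟨hyA, hy⟩, rfl⟩
    exact mem_iInter₂.2 fun w hw => ⟨y, ⟨hyA, mem_iInter₂.1 hy w hw⟩, rfl⟩
  obtain ⟨w₀⟩ : Nonempty CountableOrdinal := inferInstance
  have hQ : (A ∩ e ⁻¹' P).Infinite := fun hfin => hP <|
    ((hfin.image e).union (hPA w₀)).subset fun n hn => by
      by_cases hn' : n ∈ e '' (A ∩ V w₀)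
      · obtain ⟨y, hy, rfl⟩ := hn'
        exact Or.inl ⟨y, ⟨hy.1, hn⟩, rfl⟩
      · exact Or.inr ⟨hn, hn'⟩
  let u := hQ.natEmbedding
  refine ⟨fun k => (u k).1, fun k => (u k).2.1, ?_⟩
  rw [tendsto_subtype_rng, tendsto_pi_nhds]
  intro w
  refine tendsto_nhds_of_eventually_eq ?_
  rw [← Nat.cofinite_eq_atTop, eventually_cofinite]
  refine Finite.of_finite_image (f := fun k => e (u k)) ((hPA w).subset ?_) ?_
  · rintro _ ⟨k, hk, rfl⟩
    refine ⟨(u k).2.2, ?_⟩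
    rintro ⟨y, hy, hye⟩
    rw [he hye] at hy
    exact hk hy.2
  · intro k _ l _ hkl
    exact u.injective (Subtype.ext (he hkl))

/-- An uncountable set of coordinates, on which a subgroup of a power of a finite group is
separated, prevents it from being first countable. -/
theorem not_firstCountableTopology_subgroup {ι Y : Type*} [Uncountable ι] [Group Y] [Finite Y]
    [TopologicalSpace Y] [DiscreteTopology Y] (G : Subgroup (ι → Y))
    (hG : ∀ v w : ι, (∀ g ∈ G, g v = g w) → v = w) : ¬ FirstCountableTopology G := by
  classical
  intro hfc
  obtain ⟨U, hU⟩ := (𝓝 (1 : G)).exists_antitone_basis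
  have hF : ∀ n, ∃ F : Finset ι, ∀ g : G, (∀ v ∈ F, g.1 v = 1) → g ∈ U n := by
    intro n
    have hn := hU.1.mem_of_mem (i := n) trivial
    rw [nhds_subtype, Filter.mem_comap] at hn
    obtain ⟨t, ht, htU⟩ := hn
    rw [nhds_pi, Filter.mem_pi] at ht
    obtain ⟨I, hI, s, hs, hsub⟩ := ht
    refine ⟨hI.toFinset, fun g hg => htU (hsub fun i hi => ?_)⟩
    rw [hg i (hI.mem_toFinset.2 hi)]
    exact mem_of_mem_nhds (hs i)
  choose F hF using hF
  -- Every coordinate is controlled by one of countably many finite sets `F n`.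
  have hw : ∀ w : ι, ∃ n, ∀ g : G, (∀ v ∈ F n, g.1 v = 1) → g.1 w = 1 := by
    intro w
    have : {g : G | g.1 w = 1} ∈ 𝓝 (1 : G) :=
      ((isOpen_discrete {(1 : Y)}).preimage
        (show Continuous fun g : G => g.1 w from (continuous_apply w).comp continuous_subtype_val)).mem_nhds rfl
    obtain ⟨n, -, hn⟩ := hU.1.mem_iff.1 this
    exact ⟨n, fun g hg => hn (hF n g hg)⟩
  choose n hn using hw
  have hfib : ∀ k, (n ⁻¹' {k}).Finite := by
    intro k
    let r : G → (F k → Y) := fun g v => g.1 v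
    have hr : ∀ w ∈ n ⁻¹' {k}, ∀ g g' : G, r g = r g' → g.1 w = g'.1 w := by
      rintro w rfl g g' hgg
      have := hn w (g * g'⁻¹) fun v hv => by
        have := congrFun hgg ⟨v, hv⟩
        simpa [r, mul_inv_eq_one] using this
      simpa [mul_inv_eq_one] using this
    -- A coordinate in the fibre over `k` factors through the restriction to `F k`. There are only
    -- finitely many functions from `F k → Y` to `Y`, and distinct coordinates give distinct ones.
    have hinj : InjOn (fun w (y : F k → Y) => if h : ∃ g, r g = y then h.choose.1 w else 1)
        (n ⁻¹' {k}) := by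
      intro v hv w hw hvw
      refine hG v w fun g hg => ?_
      have h1 := congrFun hvw (r ⟨g, hg⟩)
      have hex : ∃ g', r g' = r ⟨g, hg⟩ := ⟨_, rfl⟩
      simp only [dif_pos hex] at h1
      have h2 := hr v hv _ _ hex.choose_spec
      have h3 := hr w hw _ _ hex.choose_spec
      exact h2.symm.trans (h1.trans h3)
    exact Finite.of_finite_image (toFinite _) hinj
  refine Set.not_countable_univ (α := ι) ?_
  have : (univ : Set ι) = ⋃ k, n ⁻¹' {k} := by
    ext w; simp
  rw [this]
  exact countable_iUnion fun k => (hfib k).countable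

/-- If there are no towers of length `ω₁`, then there is a separable non-metrizable Fréchet
group. -/
theorem NoTowerOfLengthOmegaOne.existsSeparableNonmetrizableFrechetGroup
    (h : NoTowerOfLengthOmegaOne) : ExistsSeparableNonmetrizableFrechetGroup := by
  classical
  have hle : Cardinal.mk CountableOrdinal ≤ Cardinal.mk (Set ℕ) := by
    rw [CountableOrdinal.mk_eq, Cardinal.mk_set, Cardinal.mk_nat, Cardinal.two_power_aleph0]
    exact Cardinal.aleph_one_le_continuum
  obtain ⟨S, hS⟩ := hle
  -- Coordinate `w` of the generators is the indicator of `S w`, so injectivity of `S` separates the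
  -- coordinates.
  let x : ℕ → CountableOrdinal → ℤˣ := fun n w => if n ∈ S w then -1 else 1
  let G : Subgroup (CountableOrdinal → ℤˣ) := Subgroup.closure (range x)
  have hc : (G : Set (CountableOrdinal → ℤˣ)).Countable := by
    have : Countable (FreeGroup ℕ) := Quot.mk_surjective.countable
    change ((Subgroup.closure (range x) : Subgroup _) : Set (CountableOrdinal → ℤˣ)).Countable
    rw [← FreeGroup.range_lift_eq_closure]
    exact countable_range _
  have := hc.to_subtype
  refine ⟨G, inferInstance, inferInstance, inferInstance, {}, ?_, h.frechetUrysohnSpace hc, ?_⟩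
  · exact ⟨univ, countable_univ, dense_univ⟩
  · intro hm
    refine not_firstCountableTopology_subgroup G (fun v w hvw => ?_) inferInstance
    refine hS (Set.ext fun n => ?_)
    have := hvw (x n) (Subgroup.subset_closure ⟨n, rfl⟩)
    by_cases h1 : n ∈ S v <;> by_cases h2 : n ∈ S w <;> simp_all [x]

theorem towerNumber_eq_of_not_exists (h : ¬ ExistsSeparableNonmetrizableFrechetGroup) :
    towerNumber = Cardinal.aleph 1 := by
  by_contra hne
  exact h (NoTowerOfLengthOmegaOne.existsSeparableNonmetrizableFrechetGroup
    fun T hT hdec => exists_pseudointersection_of_towerNumber_ne hne T hT hdec)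

/-! ### The free Boolean topological group over a compact space -/

namespace FreeBooleanGroup

variable {K : Type*}

theorem add_self (a : FreeBooleanGroup K) : a + a = 0 := by
  have h : ∀ f : K →₀ ZMod 2, f + f = 0 := fun f => Finsupp.ext fun x => by
    rw [Finsupp.add_apply, CharTwo.add_self_eq_zero]; rfl
  exact h a

theorem neg_eq (a : FreeBooleanGroup K) : -a = a :=
  neg_eq_of_add_eq_zero_left (add_self a)

theorem closure_range_of : AddSubgroup.closure (range (of : K → FreeBooleanGroup K)) = ⊤ := by
  rw [eq_top_iff]
  rintro (a : K →₀ ZMod 2) -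
  induction a using Finsupp.induction_linear with
  | zero => exact zero_mem _
  | add f g hf hg => exact add_mem hf hg
  | single x c =>
    obtain rfl | rfl : c = 0 ∨ c = 1 := by revert c; decide
    · rw [Finsupp.single_zero]; exact zero_mem _
    · exact AddSubgroup.subset_closure ⟨x, rfl⟩

/-- The sum of a tuple of generators. -/
noncomputable def tupleSum {ι : Type*} [Fintype ι] (p : ι → K) : FreeBooleanGroup K :=
  ∑ i, of (p i)

theorem exists_tupleSum_eq {X : Type*} (j : X → K) {a : FreeBooleanGroup K}
    (ha : a ∈ AddSubgroup.closure (range fun x => of (j x))) :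
    ∃ (n : ℕ) (p : Fin n → X), tupleSum (j ∘ p) = a := by
  induction ha using AddSubgroup.closure_induction with
  | mem a ha =>
    obtain ⟨x, rfl⟩ := ha
    exact ⟨1, fun _ => x, by simp [tupleSum]⟩
  | zero => exact ⟨0, Fin.elim0, by simp [tupleSum]⟩
  | add a b _ _ ha hb =>
    obtain ⟨n, p, rfl⟩ := ha
    obtain ⟨m, q, rfl⟩ := hb
    exact ⟨n + m, Fin.append p q, by simp [tupleSum, Fin.sum_univ_add]⟩
  | neg a _ ha =>
    rwa [neg_eq]

/-- The sets of the form `{x + y | (x, y) ∈ E}`. -/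
def pairSums (E : Set (K × K)) : Set (FreeBooleanGroup K) :=
  (fun q => of q.1 + of q.2) '' E

open scoped Pointwise

/-- The set of all finite sums of elements of `x₀ + y₀ + ... + xₙ + yₙ` with
`(xᵢ, yᵢ) ∈ E i`. -/
def seqSums (E : ℕ → Set (K × K)) : Set (FreeBooleanGroup K) :=
  ⋃ n, ∑ i ∈ Finset.range n, pairSums (E i)

theorem pairSums_mono {E E' : Set (K × K)} (h : E ⊆ E') : pairSums E ⊆ pairSums E' :=
  image_mono h

theorem zero_mem_seqSums (E : ℕ → Set (K × K)) : 0 ∈ seqSums E :=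
  mem_iUnion.2 ⟨0, by simp⟩

theorem seqSums_mono {E E' : ℕ → Set (K × K)} (h : ∀ i, E i ⊆ E' i) : seqSums E ⊆ seqSums E' :=
  iUnion_mono fun _ => Set.finsetSum_subset_finsetSum _ _ _ fun i _ => pairSums_mono (h i)

theorem neg_seqSums (E : ℕ → Set (K × K)) : -seqSums E = seqSums E := by
  ext a; rw [Set.mem_neg, neg_eq]

/-- The parity of the number of elements in a set. -/
noncomputable def parity (C : Set K) : FreeBooleanGroup K →+ ZMod 2 :=
  Finsupp.liftAddHom fun x => AddMonoidHom.mulLeft (C.indicator 1 x : ZMod 2)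

theorem parity_apply (C : Set K) (a : K →₀ ZMod 2) :
    parity C a = a.sum fun x c => C.indicator 1 x * c := rfl

theorem parity_of (C : Set K) (x : K) : parity C (of x) = C.indicator 1 x :=
  (parity_apply C _).trans <| (Finsupp.sum_single_index (by simp)).trans (mul_one _)

variable [TopologicalSpace K]

theorem continuous_tupleSum {ι : Type*} [Fintype ι] :
    Continuous (tupleSum : (ι → K) → FreeBooleanGroup K) :=
  continuous_finsetSum _ fun i _ => (continuous_of K).comp (continuous_apply i)

theorem zero_mem_pairSums [Nonempty K] {E : Set (K × K)} (hE : E ∈ 𝓝ˢ (diagonal K)) :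
    0 ∈ pairSums E := by
  obtain ⟨x⟩ := ‹Nonempty K›
  exact ⟨(x, x), subset_of_mem_nhdsSet hE rfl, add_self _⟩

theorem monotone_sum_pairSums [Nonempty K] {E : ℕ → Set (K × K)}
    (hE : ∀ i, E i ∈ 𝓝ˢ (diagonal K)) :
    Monotone fun n => ∑ i ∈ Finset.range n, pairSums (E i) :=
  monotone_nat_of_le_succ fun n => by
    rw [Finset.sum_range_succ]
    intro a ha
    simpa using Set.add_mem_add ha (zero_mem_pairSums (hE n))

/-- The two summands are interleaved: one uses the even terms of `E`, the other the odd ones. -/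
theorem seqSums_add_seqSums [Nonempty K] {E : ℕ → Set (K × K)}
    (hE : ∀ i, E i ∈ 𝓝ˢ (diagonal K)) :
    seqSums (fun i => E (2 * i) ∩ E (2 * i + 1)) + seqSums (fun i => E (2 * i) ∩ E (2 * i + 1)) ⊆
      seqSums E := by
  rintro _ ⟨a, ha, b, hb, rfl⟩
  obtain ⟨n, hn⟩ := mem_iUnion.1 ha
  obtain ⟨m, hm⟩ := mem_iUnion.1 hb
  have hE' : ∀ i, E (2 * i) ∩ E (2 * i + 1) ∈ 𝓝ˢ (diagonal K) := fun i =>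
    Filter.inter_mem (hE _) (hE _)
  have key : ∀ k, ∑ i ∈ Finset.range k, (pairSums (E (2 * i)) + pairSums (E (2 * i + 1))) =
      ∑ i ∈ Finset.range (2 * k), pairSums (E i) := by
    intro k
    induction k with
    | zero => simp
    | succ k ih =>
      rw [Finset.sum_range_succ, ih, Nat.mul_succ, Finset.sum_range_succ, Finset.sum_range_succ,
        add_assoc]
  refine mem_iUnion.2 ⟨2 * max n m, ?_⟩
  rw [← key, Finset.sum_add_distrib]
  refine Set.add_mem_add ?_ ?_
  · exact Set.finsetSum_subset_finsetSum _ _ _ (fun i _ => pairSums_mono inter_subset_left)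
      (monotone_sum_pairSums hE' (le_max_left n m) hn)
  · exact Set.finsetSum_subset_finsetSum _ _ _ (fun i _ => pairSums_mono inter_subset_right)
      (monotone_sum_pairSums hE' (le_max_right n m) hm)

/-- The basis of neighbourhoods of zero given by sequences of neighbourhoods of the diagonal. -/
@[reducible]
def seqSumsBasis (K : Type*) [TopologicalSpace K] [Nonempty K] :
    AddGroupFilterBasis (FreeBooleanGroup K) where
  sets := {V | ∃ E : ℕ → Set (K × K), (∀ i, E i ∈ 𝓝ˢ (diagonal K)) ∧ seqSums E = V}
  nonempty := ⟨_, fun _ => univ, fun _ => Filter.univ_mem, rfl⟩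
  inter_sets := by
    rintro _ _ ⟨E, hE, rfl⟩ ⟨E', hE', rfl⟩
    exact ⟨_, ⟨fun i => E i ∩ E' i, fun i => Filter.inter_mem (hE i) (hE' i), rfl⟩,
      subset_inter (seqSums_mono fun _ => inter_subset_left)
        (seqSums_mono fun _ => inter_subset_right)⟩
  zero' := by
    rintro _ ⟨E, hE, rfl⟩
    exact zero_mem_seqSums E
  add' := by
    rintro _ ⟨E, hE, rfl⟩
    exact ⟨_, ⟨_, fun i => Filter.inter_mem (hE _) (hE _), rfl⟩, seqSums_add_seqSums hE⟩
  neg' := by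
    rintro _ ⟨E, hE, rfl⟩
    exact ⟨_, ⟨E, hE, rfl⟩, (neg_seqSums E).ge⟩
  conj' := by
    rintro a _ ⟨E, hE, rfl⟩
    exact ⟨_, ⟨E, hE, rfl⟩, fun b hb => by simpa using hb⟩

/-- The universal property of the topology: it is finer than every group topology for which the
canonical map is continuous. -/
theorem groupTopology_le {t : TopologicalSpace (FreeBooleanGroup K)}
    (ht : @IsTopologicalAddGroup _ t _) (hof : Continuous[_, t] (of : K → FreeBooleanGroup K)) :
    (groupTopology K).toTopologicalSpace ≤ t := by
  have : groupTopology K ≤ ⟨t, ht⟩ := sInf_le (continuous_iff_coinduced_le.1 hof)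
  exact AddGroupTopology.toTopologicalSpace_le.2 this

theorem continuous_of_comp_of {H : Type*} [AddGroup H] [TopologicalSpace H]
    [IsTopologicalAddGroup H] (φ : FreeBooleanGroup K →+ H) (hφ : Continuous fun x : K => φ (of x)) :
    Continuous φ := by
  rw [continuous_iff_le_induced]
  exact groupTopology_le (topologicalAddGroup_induced φ) (continuous_induced_rng.2 hφ)

/-- These sets are a basis at zero of a group topology in which `of` is continuous, and the free
topology is finer. -/
theorem seqSums_mem_nhds [Nonempty K] {E : ℕ → Set (K × K)}
    (hE : ∀ i, E i ∈ 𝓝ˢ (diagonal K)) : seqSums E ∈ 𝓝 (0 : FreeBooleanGroup K) := by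
  have hle := groupTopology_le (K := K) (seqSumsBasis K).isTopologicalAddGroup (by
    let _ := (seqSumsBasis K).topology
    rw [continuous_iff_continuousAt]
    intro x
    rw [ContinuousAt, ((seqSumsBasis K).nhds_hasBasis _).tendsto_right_iff]
    rintro _ ⟨E, hE, rfl⟩
    have h1 : {y | (x, y) ∈ E 0} ∈ 𝓝 x :=
      (Continuous.prodMk_right x).continuousAt.preimage_mem_nhds
        (mem_nhdsSet_iff_forall.1 (hE 0) (x, x) rfl)
    filter_upwards [h1] with y hy
    refine ⟨of x + of y, mem_iUnion.2 ⟨1, ?_⟩, ?_⟩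
    · rw [Finset.sum_range_one]
      exact ⟨(x, y), hy, rfl⟩
    · simp only [← add_assoc, add_self, zero_add])
  exact nhds_mono hle ((seqSumsBasis K).mem_nhds_zero ⟨E, hE, rfl⟩)

/-- A pair on the diagonal cancels, so appending it to a tuple in `Z` stays in `U`; the tube lemma
thickens the compact diagonal. A compact `E` allows iteration. -/
theorem exists_pairSums_add_subset [CompactSpace K] [T2Space K] {U : Set (FreeBooleanGroup K)}
    (hU : ∀ n, IsOpen {p : Fin n → K | tupleSum p ∈ U}) {n : ℕ} {Z : Set (Fin n → K)}
    (hZ : IsCompact Z) (hZU : tupleSum '' Z ⊆ U) :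
    ∃ E ∈ 𝓝ˢ (diagonal K), ∃ Z' : Set (Fin (n + 2) → K), IsCompact Z' ∧
      tupleSum '' Z' = tupleSum '' Z + pairSums E ∧ tupleSum '' Z' ⊆ U := by
  let m : (Fin n → K) × (K × K) → (Fin (n + 2) → K) := fun z => Fin.append z.1 ![z.2.1, z.2.2]
  have hm : Continuous m := by
    refine continuous_pi fun i => ?_
    induction i using Fin.addCases with
    | left i => simp only [m, Fin.append_left]; fun_prop
    | right i =>
      simp only [m, Fin.append_right]
      fin_cases i <;> simp <;> fun_prop
  have hsum : ∀ z, tupleSum (m z) = tupleSum z.1 + (of z.2.1 + of z.2.2) := fun z => by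
    simp [tupleSum, m, Fin.sum_univ_add]
  have hdiag : IsCompact (diagonal K) := isClosed_diagonal.isCompact
  obtain ⟨u, v, hu, hv, hZu, hdv, huv⟩ := generalized_tube_lemma hZ hdiag ((hU (n + 2)).preimage hm)
    (by
      rintro ⟨p, x, y⟩ ⟨hp, hxy⟩
      obtain rfl : x = y := hxy
      simp only [mem_preimage, mem_ofPred_eq, hsum, add_self, add_zero]
      exact hZU ⟨p, hp, rfl⟩)
  obtain ⟨E, hE, hdE, hEv⟩ := exists_compact_between hdiag hv hdv
  have himg : tupleSum '' (m '' (Z ×ˢ E)) = tupleSum '' Z + pairSums E := by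
    ext a
    constructor
    · rintro ⟨_, ⟨z, hz, rfl⟩, rfl⟩
      rw [hsum]
      exact Set.add_mem_add (mem_image_of_mem _ hz.1)
        (mem_image_of_mem (fun q : K × K => of q.1 + of q.2) hz.2)
    · rintro ⟨_, ⟨p, hp, rfl⟩, _, ⟨q, hq, rfl⟩, rfl⟩
      exact ⟨m (p, q), mem_image_of_mem m ⟨hp, hq⟩, hsum (p, q)⟩
  refine ⟨E, mem_nhdsSet_iff_exists.2 ⟨_, isOpen_interior, hdE, interior_subset⟩, m '' (Z ×ˢ E),
    (hZ.prod hE).image hm, himg, ?_⟩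
  rintro _ ⟨_, ⟨z, hz, rfl⟩, rfl⟩
  exact huv (mk_mem_prod (hZu hz.1) (hEv hz.2))

theorem exists_seqSums_subset [CompactSpace K] [T2Space K] {U : Set (FreeBooleanGroup K)}
    (hU : ∀ n, IsOpen {p : Fin n → K | tupleSum p ∈ U}) (h0 : 0 ∈ U) :
    ∃ E : ℕ → Set (K × K), (∀ i, E i ∈ 𝓝ˢ (diagonal K)) ∧ seqSums E ⊆ U := by
  let S := {A : Set (FreeBooleanGroup K) // A ⊆ U ∧
    ∃ (n : ℕ) (Z : Set (Fin n → K)), IsCompact Z ∧ tupleSum '' Z = A}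
  have step : ∀ A : S, ∃ E ∈ 𝓝ˢ (diagonal K), ∃ B : S, B.1 = A.1 + pairSums E := by
    rintro ⟨_, hAU, n, Z, hZ, rfl⟩
    obtain ⟨E, hE, Z', hZ', h, h'⟩ := exists_pairSums_add_subset hU hZ hAU
    exact ⟨E, hE, ⟨_, h', _, Z', hZ', rfl⟩, h⟩
  choose E hE B hB using step
  let A₀ : S := ⟨{0}, by simpa using h0, 0, univ, isCompact_univ, by simp [tupleSum]⟩
  let A : ℕ → S := fun n => B^[n] A₀
  have hA : ∀ n, (A n).1 = ∑ i ∈ Finset.range n, pairSums (E (A i)) := by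
    intro n
    induction n with
    | zero => rfl
    | succ n ih =>
      rw [Finset.sum_range_succ, ← ih, ← hB]
      change (B^[n + 1] A₀).1 = _
      rw [Function.iterate_succ_apply']
  refine ⟨fun i => E (A i), fun i => hE _, iUnion_subset fun n => ?_⟩
  rw [← hA]
  exact (A n).2.1

/-- The free Boolean topological group over a compact Hausdorff space has the topology determined
by the images of the finite powers of the space. -/
theorem isOpen_of_forall_isOpen_tupleSum [CompactSpace K] [T2Space K] {U : Set (FreeBooleanGroup K)}
    (hU : ∀ n, IsOpen {p : Fin n → K | tupleSum p ∈ U}) : IsOpen U := by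
  rw [isOpen_iff_mem_nhds]
  intro a ha
  rcases isEmpty_or_nonempty K with hK | hK
  · have : U = univ := by
      refine eq_univ_of_forall fun b => ?_
      obtain rfl : b = a := (Finsupp.ext fun x => (hK.false x).elim : (b : K →₀ ZMod 2) = a)
      exact ha
    simp [this]
  obtain ⟨k, q, rfl⟩ := exists_tupleSum_eq (id : K → K) (a := a)
    (by simpa using closure_range_of (K := K) ▸ AddSubgroup.mem_top a)
  -- Translation to zero: prefixing the fixed tuple `q` is continuous, so the translate of `U` again
  -- has open traces.
  obtain ⟨E, hE, hEU⟩ := exists_seqSums_subset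
    (U := (fun b => tupleSum (id ∘ q) + b) ⁻¹' U) (fun n => by
      have hc : Continuous fun p : Fin n → K => (Fin.append q p : Fin (k + n) → K) := by
        refine continuous_pi fun i => ?_
        induction i using Fin.addCases with
        | left i => simp only [Fin.append_left]; fun_prop
        | right i => simp only [Fin.append_right]; fun_prop
      convert (hU (k + n)).preimage hc using 1
      ext p
      simp [tupleSum, Fin.sum_univ_add]) (by simpa using ha)
  have := (seqSums_mem_nhds hE)
  have h2 : (fun b => tupleSum (id ∘ q) + b) ⁻¹' U ∈ 𝓝 (0 : FreeBooleanGroup K) :=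
    Filter.mem_of_superset this hEU
  have h3 := (map_add_left_nhds_zero (tupleSum (id ∘ q) : FreeBooleanGroup K))
  rw [← h3]
  exact h2

theorem continuous_parity {C : Set K} (hC : IsClopen C) : Continuous (parity C) := by
  refine continuous_of_comp_of _ ?_
  simp only [parity_of]
  exact (continuous_const.indicator (by simp [hC.frontier_eq]))

/-- A nonzero element is detected by the parity homomorphism of a clopen set meeting its support in
one point. -/
theorem t2Space_of_clopen (hK : ∀ x y : K, x ≠ y → ∃ C : Set K, IsClopen C ∧ x ∈ C ∧ y ∉ C) :
    T2Space (FreeBooleanGroup K) := by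
  classical
  have h0 : ∀ a : FreeBooleanGroup K, a ≠ 0 → ∃ C : Set K, IsClopen C ∧ parity C a ≠ 0 := by
    intro (a : K →₀ ZMod 2) ha
    obtain ⟨x, hx⟩ := Finsupp.support_nonempty_iff.2 (show a ≠ 0 from ha)
    choose! D hD hxD hyD using hK x
    let C := ⋂ y ∈ a.support.erase x, D y
    have hC : IsClopen C := isClopen_biInter_finset fun y hy => hD y (Finset.ne_of_mem_erase hy).symm
    refine ⟨C, hC, ?_⟩
    rw [parity_apply, Finsupp.sum, Finset.sum_eq_single x]
    · have hxC : x ∈ C := mem_iInter₂.2 fun y hy => hxD y (Finset.ne_of_mem_erase hy).symm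
      simpa [hxC] using hx
    · intro y hy hyx
      have : y ∉ C := fun h => hyD y hyx.symm (mem_iInter₂.1 h y (Finset.mem_erase.2 ⟨hyx, hy⟩))
      simp [this]
    · exact fun h => (h hx).elim
  refine ⟨fun a b hab => ?_⟩
  obtain ⟨C, hC, hne⟩ := h0 (a - b) (sub_ne_zero.2 hab)
  refine separated_by_continuous (continuous_parity hC) fun h => hne ?_
  rw [map_sub, h, sub_self]

end FreeBooleanGroup

/-! ### The `γℕ` space of a maximal chain -/

/-- A sequence of length `ω₁` of sets of natural numbers, strictly increasing modulo finite sets,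
such that every infinite set has infinite intersection with one of them. -/
structure IsMaximalChain (A : CountableOrdinal → Set ℕ) : Prop where
  infinite : ∀ w, (A w).Infinite
  finite_diff : ∀ v w, v < w → (A v \ A w).Finite
  infinite_diff : ∀ v w, v < w → (A w \ A v).Infinite
  exists_infinite_inter : ∀ P : Set ℕ, P.Infinite → ∃ w, (P ∩ A w).Infinite

/-- The disjoint union of `ℕ` and `ω₁`, topologized by a sequence of sets of natural numbers. -/
def GammaSpace (_A : CountableOrdinal → Set ℕ) : Type := ℕ ⊕ CountableOrdinal

namespace GammaSpace

variable {A : CountableOrdinal → Set ℕ}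

/-- The point of the space given by a natural number. -/
def nat (n : ℕ) : GammaSpace A := Sum.inl n

/-- The point of the space given by a countable ordinal. -/
def ord (w : CountableOrdinal) : GammaSpace A := Sum.inr w

@[elab_as_elim]
theorem cases {motive : GammaSpace A → Prop} (hn : ∀ n, motive (nat n))
    (hw : ∀ w, motive (ord w)) (x : GammaSpace A) : motive x :=
  Sum.rec hn hw x

theorem nat_injective : Function.Injective (nat : ℕ → GammaSpace A) := Sum.inl_injective

theorem ord_injective : Function.Injective (ord : CountableOrdinal → GammaSpace A) :=
  Sum.inr_injective

theorem nat_ne_ord (n : ℕ) (w : CountableOrdinal) : (nat n : GammaSpace A) ≠ ord w := Sum.inl_ne_inr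

/-- The union of the initial segment `[0, w]` and `A w`. -/
def initial (w : CountableOrdinal) : Set (GammaSpace A) :=
  {x | Sum.elim (fun n => n ∈ A w) (fun v => v ≤ w) x}

theorem ord_mem_initial {v w : CountableOrdinal} :
    (ord v : GammaSpace A) ∈ initial w ↔ v ≤ w := Iff.rfl

instance : TopologicalSpace (GammaSpace A) :=
  TopologicalSpace.generateFrom
    ({s | ∃ w, s = initial w ∨ s = (initial w)ᶜ} ∪ {s | ∃ n, s = {nat n} ∨ s = {nat n}ᶜ})

theorem isClopen_initial (w : CountableOrdinal) : IsClopen (initial w : Set (GammaSpace A)) :=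
  ⟨⟨.basic _ (Or.inl ⟨w, Or.inr rfl⟩)⟩, .basic _ (Or.inl ⟨w, Or.inl rfl⟩)⟩

theorem isClopen_nat (n : ℕ) : IsClopen ({nat n} : Set (GammaSpace A)) :=
  ⟨⟨.basic _ (Or.inr ⟨n, Or.inr rfl⟩)⟩, .basic _ (Or.inr ⟨n, Or.inl rfl⟩)⟩

theorem nhds_nat (n : ℕ) : 𝓝 (nat n : GammaSpace A) = pure (nat n) :=
  (isOpen_singleton_iff_nhds_eq_pure _).1 (isClopen_nat n).isOpen

instance : T2Space (GammaSpace A) := by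
  have key : ∀ x y : GammaSpace A, x ≠ y →
      ∃ C : Set (GammaSpace A), IsClopen C ∧ (x ∈ C ∧ y ∉ C ∨ y ∈ C ∧ x ∉ C) := by
    intro x y hxy
    induction x using cases with
    | hn n => exact ⟨_, isClopen_nat n, Or.inl ⟨rfl, hxy.symm⟩⟩
    | hw v =>
      induction y using cases with
      | hn n => exact ⟨_, isClopen_nat n, Or.inr ⟨rfl, hxy⟩⟩
      | hw w =>
        rcases lt_trichotomy v w with h | rfl | h
        · exact ⟨_, isClopen_initial v, Or.inl ⟨le_refl v, not_le.2 h⟩⟩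
        · exact (hxy rfl).elim
        · exact ⟨_, isClopen_initial w, Or.inr ⟨le_refl w, not_le.2 h⟩⟩
  refine ⟨fun x y hxy => ?_⟩
  obtain ⟨C, hC, h | h⟩ := key x y hxy
  · exact ⟨C, Cᶜ, hC.isOpen, hC.compl.isOpen, h.1, h.2, disjoint_compl_right⟩
  · exact ⟨Cᶜ, C, hC.compl.isOpen, hC.isOpen, h.2, h.1, disjoint_compl_left⟩

open Filter

/-- Subbasic sets `initial v` with `v > w` are redundant: they contain `initial w` up to finitely
many naturals. Countably many conditions remain, whence first countability. -/
theorem nhds_ord (hA : IsMaximalChain A) (w : CountableOrdinal) :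
    𝓝 (ord w : GammaSpace A) =
      𝓟 (initial w) ⊓ (⨅ v : Iio w, 𝓟 (initial v.1)ᶜ) ⊓ ⨅ n, 𝓟 {nat n}ᶜ := by
  refine le_antisymm (le_inf (le_inf ?_ (le_iInf fun v => ?_)) (le_iInf fun n => ?_)) ?_
  · exact le_principal_iff.2 ((isClopen_initial w).isOpen.mem_nhds (le_refl w))
  · refine le_principal_iff.2 ((isClopen_initial v.1).compl.isOpen.mem_nhds ?_)
    exact not_le.2 (mem_Iio.1 v.2)
  · exact le_principal_iff.2 ((isClopen_nat n).compl.isOpen.mem_nhds (nat_ne_ord n w).symm)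
  rw [TopologicalSpace.nhds_generateFrom]
  have hnat : ∀ n, ({nat n}ᶜ : Set (GammaSpace A)) ∈
      𝓟 (initial w) ⊓ (⨅ v : Iio w, 𝓟 (initial v.1)ᶜ) ⊓ ⨅ n, 𝓟 {nat n}ᶜ := fun n =>
    mem_inf_of_right (mem_iInf_of_mem n (mem_principal_self _))
  refine le_iInf₂ fun s hs => le_principal_iff.2 ?_
  obtain ⟨hws, ⟨v, rfl | rfl⟩ | ⟨n, rfl | rfl⟩⟩ := hs
  · have hwv : w ≤ v := hws
    have hfin : (A w \ A v).Finite := by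
      rcases hwv.eq_or_lt with rfl | h
      · simp
      · exact hA.finite_diff w v h
    have h1 : (⋂ n ∈ A w \ A v, {nat n}ᶜ : Set (GammaSpace A)) ∈
        𝓟 (initial w) ⊓ (⨅ v : Iio w, 𝓟 (initial v.1)ᶜ) ⊓ ⨅ n, 𝓟 {nat n}ᶜ :=
      (biInter_mem hfin).2 fun n _ => hnat n
    have h2 : initial w ∈
        𝓟 (initial w) ⊓ (⨅ v : Iio w, 𝓟 (initial v.1)ᶜ) ⊓ ⨅ n, 𝓟 ({nat n}ᶜ : Set (GammaSpace A)) :=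
      mem_inf_of_left (mem_inf_of_left (mem_principal_self _))
    filter_upwards [h1, h2] with x hx1 hx2
    induction x using cases with
    | hn n =>
      by_contra hn
      exact mem_iInter₂.1 hx1 n ⟨hx2, hn⟩ rfl
    | hw u => exact le_trans (ord_mem_initial.1 hx2) hwv
  · have hvw : v < w := not_le.1 hws
    exact mem_inf_of_left (mem_inf_of_right (mem_iInf_of_mem ⟨v, hvw⟩ (mem_principal_self _)))
  · exact (nat_ne_ord n w hws.symm).elim
  · exact hnat n

theorem tendsto_nhds_ord_iff (hA : IsMaximalChain A) {β : Type*} {l : Filter β}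
    {f : β → GammaSpace A} {w : CountableOrdinal} :
    Tendsto f l (𝓝 (ord w)) ↔ (∀ᶠ b in l, f b ∈ initial w) ∧
      (∀ v < w, ∀ᶠ b in l, f b ∉ initial v) ∧ ∀ n, ∀ᶠ b in l, f b ≠ nat n := by
  simp [nhds_ord hA, tendsto_inf, tendsto_iInf, tendsto_principal, and_assoc]

theorem firstCountableTopology (hA : IsMaximalChain A) :
    FirstCountableTopology (GammaSpace A) where
  nhds_generated_countable x := by
    induction x using cases with
    | hn n => rw [nhds_nat]; infer_instance
    | hw w =>
      have := (CountableOrdinal.countable_Iio w).to_subtype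
      rw [nhds_ord hA]
      infer_instance

theorem isCompact_initial (hA : IsMaximalChain A) (w : CountableOrdinal) :
    IsCompact (initial w : Set (GammaSpace A)) := by
  rw [isCompact_iff_ultrafilter_le_nhds]
  intro u hu
  rw [le_principal_iff] at hu
  by_cases hn : ∃ n, {nat n} ∈ u
  · obtain ⟨n, hn⟩ := hn
    refine ⟨nat n, ?_, ?_⟩
    · obtain ⟨x, rfl, hx2⟩ := u.nonempty_of_mem (inter_mem hn hu)
      exact hx2
    · rw [nhds_nat, ← principal_singleton]
      exact le_principal_iff.2 hn
  push Not at hn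
  have hcompl : ∀ n, ({nat n}ᶜ : Set (GammaSpace A)) ∈ u := fun n =>
    Ultrafilter.compl_mem_iff_notMem.2 (hn n)
  -- A nonprincipal limit is the least `v` whose initial set belongs to the ultrafilter.
  obtain ⟨v, hv, hmin⟩ := WellFounded.has_min (wellFounded_lt (α := CountableOrdinal))
    {v | initial v ∈ u} ⟨w, hu⟩
  refine ⟨ord v, not_lt.1 (hmin w hu), ?_⟩
  refine (tendsto_nhds_ord_iff hA (f := id) (l := (u : Filter (GammaSpace A)))).2
    ⟨hv, fun v' hv' => ?_, hcompl⟩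
  exact Ultrafilter.compl_mem_iff_notMem.2 fun h => hmin v' h hv'

theorem exists_isCompact_isClopen (hA : IsMaximalChain A) {x y : GammaSpace A} (hxy : x ≠ y) :
    ∃ C : Set (GammaSpace A), IsCompact C ∧ IsClopen C ∧ x ∈ C ∧ y ∉ C := by
  induction x using cases with
  | hn n => exact ⟨_, isCompact_singleton, isClopen_nat n, rfl, hxy.symm⟩
  | hw w =>
    induction y using cases with
    | hn n =>
      exact ⟨initial w ∩ {nat n}ᶜ, (isCompact_initial hA w).inter_right (isClopen_nat n).compl.isClosed,
        (isClopen_initial w).inter (isClopen_nat n).compl, ⟨le_refl w, hxy⟩, fun h => h.2 rfl⟩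
    | hw v =>
      rcases lt_or_ge v w with h | h
      · exact ⟨initial w ∩ (initial v)ᶜ,
          (isCompact_initial hA w).inter_right (isClopen_initial v).compl.isClosed,
          (isClopen_initial w).inter (isClopen_initial v).compl,
          ⟨le_refl w, not_le.2 h⟩, fun h' => h'.2 (le_refl v)⟩
      · refine ⟨initial w, isCompact_initial hA w, isClopen_initial w, le_refl w, fun h' => hxy ?_⟩
        rw [le_antisymm h (ord_mem_initial.1 h')]

theorem locallyCompactSpace (hA : IsMaximalChain A) : LocallyCompactSpace (GammaSpace A) := by
  have : WeaklyLocallyCompactSpace (GammaSpace A) := ⟨fun x => by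
    induction x using cases with
    | hn n => exact ⟨_, isCompact_singleton, (isClopen_nat n).isOpen.mem_nhds rfl⟩
    | hw w => exact ⟨_, isCompact_initial hA w, (isClopen_initial w).isOpen.mem_nhds (le_refl w)⟩⟩
  infer_instance

/-- A sequence with no frequently repeated natural value visits some compact `initial w` frequently:
its ordinal values are bounded, and infinitely many natural values are caught by maximality of the
chain. -/
theorem countablyCompactSpace (hA : IsMaximalChain A) : CountablyCompactSpace (GammaSpace A) := by
  refine ⟨isCountablyCompact_iff_seq_clusterPt.2 fun x _ => ?_⟩
  simp only [mem_univ, true_and]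
  have hfreq : ∀ w, (∃ᶠ k in atTop, x k ∈ initial w) → ∃ a, MapClusterPt a atTop x := fun w hw => by
    obtain ⟨a, -, ha⟩ := (isCompact_initial hA w).exists_mapClusterPt_of_frequently hw
    exact ⟨a, ha⟩
  by_cases h1 : ∃ᶠ k in atTop, x k ∈ range ord
  · have hc : (ord ⁻¹' (range x) : Set CountableOrdinal).Countable :=
      (countable_range x).preimage ord_injective
    obtain ⟨w, hw⟩ := CountableOrdinal.exists_forall_lt hc
    refine hfreq w (h1.mono ?_)
    rintro k ⟨v, hv⟩
    rw [← hv]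
    exact (hw v ⟨k, hv.symm⟩).le
  by_cases h2 : ∃ n, ∃ᶠ k in atTop, x k = nat n
  · obtain ⟨n, hn⟩ := h2
    refine ⟨nat n, mapClusterPt_iff_frequently.2 fun s hs => hn.mono fun k hk => ?_⟩
    rw [hk]
    exact mem_of_mem_nhds hs
  push Not at h2
  have hP : (nat ⁻¹' (range x) : Set ℕ).Infinite := by
    intro hfin
    have h3 : ∀ᶠ k in atTop, ∀ n ∈ nat ⁻¹' (range x), x k ≠ nat n :=
      (hfin.eventually_all).2 fun n _ => h2 n
    obtain ⟨k, hk, hk2⟩ := (h3.and (not_frequently.1 h1)).exists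
    generalize hx : x k = y at hk hk2
    induction y using cases with
    | hn n => exact hk n ⟨k, hx⟩ rfl
    | hw w => exact hk2 ⟨w, rfl⟩
  obtain ⟨w, hw⟩ := hA.exists_infinite_inter _ hP
  refine hfreq w fun hev => ?_
  rw [← Nat.cofinite_eq_atTop, eventually_cofinite] at hev
  refine hw (Finite.of_finite_image ((hev.image x).subset ?_) nat_injective.injOn)
  rintro _ ⟨n, ⟨⟨k, hk⟩, hn⟩, rfl⟩
  refine ⟨k, ?_, hk⟩
  rw [mem_ofPred_eq, not_not]
  change x k ∈ initial w
  rw [hk]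
  exact hn

theorem exists_tendsto_ord (hA : IsMaximalChain A) (w : CountableOrdinal) :
    ∃ u : ℕ → ℕ, Tendsto (fun k => (nat (u k) : GammaSpace A)) atTop (𝓝 (ord w)) := by
  have := (CountableOrdinal.countable_Iio w).to_subtype
  -- The bottom index contributes `A w` itself, which is needed when `w` has no predecessors.
  let T : WithBot (Iio w) → Set ℕ := fun v => v.recBotCoe (A w) fun v => A w \ A v
  have hinf : ∀ v, (T v).Infinite := fun v => by
    induction v using WithBot.recBotCoe with
    | bot => exact hA.infinite w
    | coe v => exact hA.infinite_diff v w v.2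
  have hdec : ∀ u v, u < v → (T v \ T u).Finite := fun u v huv => by
    induction v using WithBot.recBotCoe with
    | bot => exact (not_lt_bot huv).elim
    | coe v =>
      induction u using WithBot.recBotCoe with
      | bot =>
        refine finite_empty.subset fun n hn => hn.2 hn.1.1
      | coe u =>
        refine (hA.finite_diff u v (show u < v from WithBot.coe_lt_coe.1 huv)).subset fun n hn => ?_
        exact ⟨by_contra fun h => hn.2 ⟨hn.1.1, h⟩, hn.1.2⟩
  have : Countable (WithBot (Iio w)) := inferInstanceAs (Countable (Option (Iio w)))
  obtain ⟨P, hP, hPT⟩ := exists_infinite_pseudointersection T (infinite_biInter hinf hdec)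
  let u := hP.natEmbedding
  have hu : ∀ S : Set ℕ, (P \ S).Finite → ∀ᶠ k in atTop, (u k).1 ∈ S := fun S hS => by
    rw [← Nat.cofinite_eq_atTop, eventually_cofinite]
    refine Finite.of_finite_image (f := fun k => (u k).1) (hS.subset ?_) ?_
    · rintro _ ⟨k, hk, rfl⟩
      exact ⟨(u k).2, hk⟩
    · exact fun k _ l _ hkl => u.injective (Subtype.ext hkl)
  refine ⟨fun k => u k, (tendsto_nhds_ord_iff hA).2 ⟨hu _ (hPT ⊥), fun v hv => ?_, fun n => ?_⟩⟩
  · exact (hu _ (hPT ((⟨v, hv⟩ : Iio w) : WithBot (Iio w)))).mono fun k hk => hk.2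
  · refine (hu {n}ᶜ ((finite_singleton n).subset fun m hm => not_not.1 hm.2)).mono fun k hk => ?_
    exact fun h => hk (nat_injective h)

theorem not_isOpen_ord (hA : IsMaximalChain A) (w : CountableOrdinal) :
    ¬ IsOpen ({ord w} : Set (GammaSpace A)) := fun h => by
  obtain ⟨u, hu⟩ := exists_tendsto_ord hA w
  obtain ⟨k, hk⟩ := (hu.eventually (h.mem_nhds rfl)).exists
  exact nat_ne_ord _ _ hk

theorem denseRange_nat (hA : IsMaximalChain A) : DenseRange (nat : ℕ → GammaSpace A) := fun x => by
  induction x using cases with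
  | hn n => exact subset_closure ⟨n, rfl⟩
  | hw w =>
    obtain ⟨u, hu⟩ := exists_tendsto_ord hA w
    exact mem_closure_of_tendsto hu (Eventually.of_forall fun k => ⟨u k, rfl⟩)

theorem setOf_isOpen_singleton (hA : IsMaximalChain A) :
    {x : GammaSpace A | IsOpen {x}} = range nat := by
  ext x
  induction x using cases with
  | hn n => exact iff_of_true (isClopen_nat n).isOpen ⟨n, rfl⟩
  | hw w => exact iff_of_false (not_isOpen_ord hA w) fun ⟨n, hn⟩ => nat_ne_ord n w hn

theorem isEmbedding_ord_toTypeMk :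
    IsEmbedding fun o : Iio (Ordinal.omega.{0} 1) => (ord (Ordinal.ToType.mk o) : GammaSpace A) := by
  refine ⟨⟨le_antisymm ?_ ?_⟩, fun a b hab => Ordinal.ToType.mk.injective (ord_injective hab)⟩
  · rw [← continuous_iff_le_induced, continuous_generateFrom_iff]
    have hcl : ∀ w : CountableOrdinal,
        IsClopen {o : Iio (Ordinal.omega.{0} 1) | Ordinal.ToType.mk o ≤ w} := by
      intro w
      constructor
      · have : {o : Iio (Ordinal.omega.{0} 1) | Ordinal.ToType.mk o ≤ w} =
            Iic (Ordinal.ToType.mk.symm w) := by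
          ext o; exact (Ordinal.ToType.mk.le_symm_apply (x := o) (y := w)).symm
        rw [this]; exact isClosed_Iic
      · have : {o : Iio (Ordinal.omega.{0} 1) | Ordinal.ToType.mk o ≤ w} =
            Iio (Ordinal.ToType.mk.symm (Order.succ w)) := by
          ext o
          exact (Order.lt_succ_iff (a := Ordinal.ToType.mk o) (b := w)).symm.trans
            (Ordinal.ToType.mk.lt_symm_apply (x := o) (y := Order.succ w)).symm
        rw [this]; exact isOpen_Iio
    have hem : ∀ n, (fun o : Iio (Ordinal.omega.{0} 1) => (ord (Ordinal.ToType.mk o) : GammaSpace A))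
        ⁻¹' {nat n} = ∅ := fun n => by
      ext o
      exact iff_of_false (fun h => nat_ne_ord _ _ (Eq.symm h)) (fun h => h)
    rintro s (⟨w, rfl | rfl⟩ | ⟨n, rfl | rfl⟩)
    · exact (hcl w).isOpen
    · exact (hcl w).compl.isOpen
    · rw [hem]; exact isOpen_empty
    · rw [preimage_compl, hem, compl_empty]; exact isOpen_univ
  · rw [OrderTopology.topology_eq_generate_intervals (α := Iio (Ordinal.omega.{0} 1))]
    let _ : TopologicalSpace (Iio (Ordinal.omega.{0} 1)) := .induced
      (fun o => (ord (Ordinal.ToType.mk o) : GammaSpace A)) inferInstance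
    have hcont : Continuous fun o : Iio (Ordinal.omega.{0} 1) =>
        (ord (Ordinal.ToType.mk o) : GammaSpace A) := continuous_induced_dom
    refine le_generateFrom ?_
    rintro s ⟨a, rfl | rfl⟩
    · have : Ioi a = (fun o => (ord (Ordinal.ToType.mk o) : GammaSpace A)) ⁻¹'
          (initial (Ordinal.ToType.mk a))ᶜ := by
        ext o
        simp [ord_mem_initial]
      rw [this]
      exact (isClopen_initial _).compl.isOpen.preimage hcont
    · have : Iio a = ⋃ b ∈ Iio a, (fun o => (ord (Ordinal.ToType.mk o) : GammaSpace A)) ⁻¹'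
          (initial (Ordinal.ToType.mk b)) := by
        ext o
        simp only [mem_Iio, mem_iUnion, mem_preimage, ord_mem_initial, OrderIso.le_iff_le]
        exact ⟨fun h => ⟨o, h, le_rfl⟩, fun ⟨b, hb, hob⟩ => hob.trans_lt hb⟩
      rw [this]
      exact isOpen_biUnion fun b _ => (isClopen_initial _).isOpen.preimage hcont

theorem isGammaN (hA : IsMaximalChain A) : IsGammaN (GammaSpace A) where
  t2 := inferInstance
  locallyCompact := locallyCompactSpace hA
  countable_isolated := by
    rw [setOf_isOpen_singleton hA]; exact countable_range _
  dense_isolated := by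
    rw [setOf_isOpen_singleton hA]; exact denseRange_nat hA
  remainder := by
    have : {x : GammaSpace A | ¬ IsOpen {x}} =
        range fun o : Iio (Ordinal.omega.{0} 1) => (ord (Ordinal.ToType.mk o) : GammaSpace A) := by
      ext x
      induction x using cases with
      | hn n =>
        refine iff_of_false (not_not.2 (isClopen_nat n).isOpen) ?_
        rintro ⟨o, ho⟩
        exact nat_ne_ord _ _ ho.symm
      | hw w =>
        obtain ⟨v, rfl⟩ := Ordinal.ToType.mk.surjective w
        exact iff_of_true (not_isOpen_ord hA _) ⟨v, rfl⟩
    rw [this]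
    exact ⟨(isEmbedding_ord_toTypeMk).toHomeomorph.symm⟩

/-- Every point has a neighbourhood containing only boundedly many ordinals, so a cofinal set of
ordinals cannot cluster. -/
theorem eventually_ord_notMem {C : Set (GammaSpace A)} (hC : IsCompact C) :
    ∀ᶠ w in atTop, ord w ∉ C := by
  by_contra hcon
  obtain ⟨x, -, hx⟩ := hC.exists_mapClusterPt_of_frequently (l := atTop) (f := ord)
    (not_eventually.1 hcon |>.mono fun _ h => not_not.1 h)
  induction x using cases with
  | hn n =>
    obtain ⟨w, hw⟩ := (mapClusterPt_iff_frequently.1 hx {nat n} ((isClopen_nat n).isOpen.mem_nhds rfl)).exists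
    exact nat_ne_ord n w hw.symm
  | hw v =>
    refine mapClusterPt_iff_frequently.1 hx _ ((isClopen_initial v).isOpen.mem_nhds (le_refl v)) ?_
    filter_upwards [eventually_gt_atTop v] with w hw
    exact not_le.2 hw

theorem tendsto_ord_infty :
    Tendsto (fun w => ((ord w : GammaSpace A) : OnePoint (GammaSpace A))) atTop
      (𝓝 OnePoint.infty) := by
  refine OnePoint.tendsto_coe_infty.comp ?_
  rw [hasBasis_coclosedCompact.tendsto_right_iff]
  exact fun C hC => eventually_ord_notMem hC.2

theorem exists_isClopen_onePoint (hA : IsMaximalChain A) (x y : OnePoint (GammaSpace A))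
    (hxy : x ≠ y) : ∃ C : Set (OnePoint (GammaSpace A)), IsClopen C ∧ x ∈ C ∧ y ∉ C := by
  have himg : ∀ C : Set (GammaSpace A), IsCompact C → IsClopen C →
      IsClopen ((↑) '' C : Set (OnePoint (GammaSpace A))) := fun C hC hC' =>
    ⟨OnePoint.isClosed_image_coe.2 ⟨hC'.isClosed, hC⟩, OnePoint.isOpen_image_coe.2 hC'.isOpen⟩
  have hmem : ∀ x : GammaSpace A, ∃ C : Set (GammaSpace A), IsCompact C ∧ IsClopen C ∧ x ∈ C :=
    fun x => by
      induction x using cases with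
      | hn n => exact ⟨_, isCompact_singleton, isClopen_nat n, rfl⟩
      | hw w => exact ⟨_, isCompact_initial hA w, isClopen_initial w, le_refl w⟩
  induction x using OnePoint.rec with
  | infty =>
    induction y using OnePoint.rec with
    | infty => exact (hxy rfl).elim
    | coe y =>
      obtain ⟨C, hC, hC', hy⟩ := hmem y
      exact ⟨_, (himg C hC hC').compl, by simp, fun h => h ⟨y, hy, rfl⟩⟩
  | coe x =>
    induction y using OnePoint.rec with
    | infty =>
      obtain ⟨C, hC, hC', hx⟩ := hmem x
      exact ⟨_, himg C hC hC', ⟨x, hx, rfl⟩, by simp⟩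
    | coe y =>
      obtain ⟨C, hC, hC', hx, hy⟩ := exists_isCompact_isClopen hA (fun h => hxy (congrArg _ h))
      refine ⟨_, himg C hC hC', ⟨x, hx, rfl⟩, ?_⟩
      rintro ⟨z, hz, hzy⟩
      rw [OnePoint.coe_injective hzy] at hz
      exact hy hz

end GammaSpace

/-! ### Finite powers of `X` and the subgroup it generates -/

open Filter

theorem exists_tendsto_subseq_pi {ι X : Type*} [Finite ι] [TopologicalSpace X] [SeqCompactSpace X]
    (u : ℕ → ι → X) :
    ∃ (a : ι → X) (φ : ℕ → ℕ), StrictMono φ ∧ Tendsto (u ∘ φ) atTop (𝓝 a) := by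
  classical
  cases nonempty_fintype ι
  have key : ∀ s : Finset ι, ∃ φ : ℕ → ℕ, StrictMono φ ∧
      ∀ i ∈ s, ∃ a, Tendsto (fun k => u (φ k) i) atTop (𝓝 a) := by
    intro s
    induction s using Finset.induction_on with
    | empty => exact ⟨id, strictMono_id, by simp⟩
    | insert i s _ ih =>
      obtain ⟨φ, hφ, hs⟩ := ih
      obtain ⟨a, ψ, hψ, ha⟩ := SeqCompactSpace.tendsto_subseq fun k => u (φ k) i
      refine ⟨φ ∘ ψ, hφ.comp hψ, fun j hj => ?_⟩
      rcases Finset.mem_insert.1 hj with rfl | hj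
      · exact ⟨a, ha⟩
      · obtain ⟨b, hb⟩ := hs j hj
        exact ⟨b, hb.comp hψ.tendsto_atTop⟩
  obtain ⟨φ, hφ, h⟩ := key Finset.univ
  choose a ha using fun i => h i (Finset.mem_univ i)
  exact ⟨a, φ, hφ, tendsto_pi_nhds.2 ha⟩

instance seqCompactSpace_pi {ι X : Type*} [Finite ι] [TopologicalSpace X] [SeqCompactSpace X] :
    SeqCompactSpace (ι → X) :=
  ⟨fun u _ => by simpa using exists_tendsto_subseq_pi u⟩

namespace GammaSpace

variable {A : CountableOrdinal → Set ℕ}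

/-- The retraction of the one-point compactification which maps the point at infinity to a given
ordinal. -/
def retract (w : CountableOrdinal) (z : OnePoint (GammaSpace A)) : GammaSpace A :=
  z.elim (ord w) id

@[simp]
theorem retract_coe (w : CountableOrdinal) (x : GammaSpace A) : retract w x = x := rfl

@[simp]
theorem retract_infty (w : CountableOrdinal) :
    retract w (OnePoint.infty : OnePoint (GammaSpace A)) = ord w := rfl

/-- The embedding of a finite power of the space in the power of its one-point compactification. -/
def coeTuple {ι : Type*} (q : ι → GammaSpace A) : ι → OnePoint (GammaSpace A) := fun i => q i

/-- Sequential compactness of `X ^ n` replaces approximation of `p` by a point of `C` that equals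
`p` at the finite coordinates and has large ordinals in place of `∞`. -/
theorem exists_mem_of_mem_closure (hA : IsMaximalChain A) {ι : Type*} [Finite ι]
    {C : Set (ι → GammaSpace A)} (hC : IsClosed C) {p : ι → OnePoint (GammaSpace A)}
    (hp : p ∈ closure (coeTuple '' C)) (α : CountableOrdinal) :
    ∃ c ∈ C, ∀ i, (∀ x : GammaSpace A, p i = x → c i = x) ∧
      (p i = OnePoint.infty → ∃ β, α < β ∧ c i = ord β) := by
  have := firstCountableTopology hA
  have := countablyCompactSpace hA
  -- At `∞` a coarser, countably generated filter is used so that a sequence can be extracted; it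
  -- still forces limits to be ordinals above `α`.
  let M : OnePoint (GammaSpace A) → Filter (GammaSpace A) := fun z =>
    z.elim (𝓟 (initial α)ᶜ ⊓ ⨅ n, 𝓟 {nat n}ᶜ) 𝓝
  have hM : ∀ z, comap (↑) (𝓝 z) ≤ M z := by
    intro z
    induction z using OnePoint.rec with
    | infty =>
      rw [OnePoint.comap_coe_nhds_infty]
      refine le_inf ?_ (le_iInf fun n => ?_) <;> refine le_principal_iff.2 ?_
      · exact (isCompact_initial hA α).compl_mem_coclosedCompact_of_isClosed
          (isClopen_initial α).isClosed
      · exact isCompact_singleton.compl_mem_coclosedCompact_of_isClosed isClosed_singleton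
    | coe x => exact (OnePoint.comap_coe_nhds x).le
  have hMc : ∀ z, (M z).IsCountablyGenerated := by
    intro z
    induction z using OnePoint.rec with
    | infty => change (_ ⊓ _ : Filter (GammaSpace A)).IsCountablyGenerated; infer_instance
    | coe x => change (𝓝 x).IsCountablyGenerated; infer_instance
  have hle : comap coeTuple (𝓝 p) ≤ Filter.pi fun i => M (p i) := by
    rw [Filter.le_pi]
    intro i
    refine Tendsto.mono_right ?_ (hM (p i))
    rw [tendsto_comap_iff]
    exact ((continuous_apply i).tendsto p).comp tendsto_comap
  have hne : (𝓟 C ⊓ Filter.pi fun i => M (p i)).NeBot := by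
    refine NeBot.mono ?_ (inf_le_inf_left _ hle)
    rw [neBot_inf_comap_iff_map, map_principal, inf_comm]
    exact mem_closure_iff_clusterPt.1 hp
  have hcg : (Filter.pi fun i => M (p i)).IsCountablyGenerated := inferInstance
  obtain ⟨u, hu⟩ := (𝓟 C ⊓ Filter.pi fun i => M (p i)).exists_seq_tendsto
  rw [tendsto_inf, tendsto_principal, tendsto_pi] at hu
  obtain ⟨c, φ, hφ, hc⟩ := exists_tendsto_subseq_pi u
  have hci := tendsto_pi_nhds.1 hc
  refine ⟨c, hC.mem_of_tendsto hc (hφ.tendsto_atTop.eventually hu.1), fun i => ⟨fun x hx => ?_,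
    fun hinf => ?_⟩⟩
  · have h1 := (hu.2 i).comp hφ.tendsto_atTop
    rw [hx] at h1
    exact tendsto_nhds_unique (hci i) h1
  · have h1 := (hu.2 i).comp hφ.tendsto_atTop
    rw [hinf] at h1
    change Tendsto _ _ (_ ⊓ _) at h1
    rw [tendsto_inf, tendsto_principal, tendsto_iInf] at h1
    have h2 : c i ∉ initial α :=
      (isClopen_initial α).compl.isClosed.mem_of_tendsto (hci i) h1.1
    have h3 : ∀ n, c i ≠ nat n := fun n hn => by
      obtain ⟨k, hk, hk'⟩ := ((tendsto_principal.1 (h1.2 n)).and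
        ((hci i).eventually ((isClopen_nat n).isOpen.mem_nhds hn))).exists
      exact hk hk'
    generalize c i = y at h2 h3
    induction y using cases with
    | hn n => exact (h3 n rfl).elim
    | hw β => exact ⟨β, not_le.1 h2, rfl⟩

/-- Closing off: iterating the preceding lemma interleaves the replacing ordinals with a sequence `a
k`. Hence they all converge to the same supremum `w`, and the limit tuple lies in the closed set
`C`. -/
theorem frequently_retract_mem (hA : IsMaximalChain A) {ι : Type*} [Finite ι]
    {C : Set (ι → GammaSpace A)} (hC : IsClosed C) {p : ι → OnePoint (GammaSpace A)}
    (hp : p ∈ closure (coeTuple '' C)) : ∃ᶠ w in atTop, retract w ∘ p ∈ C := by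
  have step : ∀ α : CountableOrdinal, ∃ α', α < α' ∧ ∃ c ∈ C, ∀ i,
      (∀ x : GammaSpace A, p i = x → c i = x) ∧
      (p i = OnePoint.infty → ∃ β, α < β ∧ β < α' ∧ c i = ord β) := by
    intro α
    obtain ⟨c, hc, h⟩ := exists_mem_of_mem_closure hA hC hp α
    have hfin : ((ord ⁻¹' range c) ∪ {α}).Countable :=
      ((countable_range c).preimage ord_injective).union (countable_singleton α)
    obtain ⟨α', hα'⟩ := CountableOrdinal.exists_forall_lt hfin
    refine ⟨α', hα' α (Or.inr rfl), c, hc, fun i => ⟨(h i).1, fun hi => ?_⟩⟩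
    obtain ⟨β, hβ, hcβ⟩ := (h i).2 hi
    exact ⟨β, hβ, hα' β (Or.inl ⟨i, hcβ⟩), hcβ⟩
  choose nx hnx c hcC hc using step
  rw [frequently_atTop]
  intro α
  let a : ℕ → CountableOrdinal := fun k => nx^[k] α
  have ha : ∀ k, a (k + 1) = nx (a k) := fun k => Function.iterate_succ_apply' nx k α
  have hmono : StrictMono a := strictMono_nat_of_lt_succ fun k => by rw [ha]; exact hnx _
  obtain ⟨w, hw, hmin⟩ := WellFounded.has_min (wellFounded_lt (α := CountableOrdinal))
    {w | ∀ k, a k < w} (by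
      obtain ⟨w, hw⟩ := CountableOrdinal.exists_forall_lt (countable_range a)
      exact ⟨w, fun k => hw _ ⟨k, rfl⟩⟩)
  refine ⟨w, (hw 0).le, hC.mem_of_tendsto (f := fun k => c (a k)) (b := atTop) ?_
    (Eventually.of_forall fun k => hcC _)⟩
  rw [tendsto_pi_nhds]
  intro i
  have hci := fun k => hc (a k) i
  change Tendsto _ _ (𝓝 (retract w (p i)))
  generalize p i = z at hci
  induction z using OnePoint.rec with
  | coe x => simp [(hci _).1 x rfl]
  | infty =>
    rw [retract_infty, tendsto_nhds_ord_iff hA]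
    choose β hβ hβ' hcβ using fun k => (hci k).2 rfl
    refine ⟨Eventually.of_forall fun k => ?_, fun v hv => ?_, fun n => Eventually.of_forall fun k => ?_⟩
    · rw [hcβ, ord_mem_initial]
      exact ((hβ' k).trans (by rw [← ha]; exact hw _)).le
    · have : ∃ k, v ≤ a k := by
        by_contra! hcon
        exact hmin v hcon hv
      obtain ⟨k, hk⟩ := this
      filter_upwards [eventually_ge_atTop k] with l hl
      rw [hcβ, ord_mem_initial, not_le]
      exact hk.trans_lt ((hmono.monotone hl).trans_lt (hβ l))
    · rw [hcβ]; exact (nat_ne_ord n _).symm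

theorem isOpen_setOf_eventually_retract_mem (hA : IsMaximalChain A) {ι : Type*} [Finite ι]
    {U : Set (ι → GammaSpace A)} (hU : IsOpen U) :
    IsOpen {p : ι → OnePoint (GammaSpace A) | ∀ᶠ w in atTop, retract w ∘ p ∈ U} := by
  rw [← isClosed_compl_iff]
  refine isClosed_of_closure_subset fun p hp => ?_
  -- The complement is closed: it lies in this closure because `ord w` tends to `∞`, and
  -- `frequently_retract_mem` gives the reverse inclusion.
  have hsub : {p : ι → OnePoint (GammaSpace A) | ∀ᶠ w in atTop, retract w ∘ p ∈ U}ᶜ ⊆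
      closure (coeTuple '' Uᶜ) := by
    intro q hq
    have hq : ∃ᶠ w in atTop, retract w ∘ q ∈ Uᶜ := not_eventually.1 hq
    refine mem_closure_of_frequently_of_tendsto (f := fun w => coeTuple (retract w ∘ q))
      (hq.mono fun w hw => mem_image_of_mem _ hw) ?_
    rw [tendsto_pi_nhds]
    intro i
    change Tendsto (fun w => ((retract w (q i) : GammaSpace A) : OnePoint (GammaSpace A))) _ _
    generalize q i = z
    induction z using OnePoint.rec with
    | coe x => exact tendsto_const_nhds
    | infty => exact tendsto_ord_infty
  exact not_eventually.2
    (frequently_retract_mem hA hU.isClosed_compl (closure_minimal hsub isClosed_closure hp))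

open FreeBooleanGroup

variable (A) in
/-- The tuple sums, as elements of the subgroup generated by the space. -/
noncomputable def subgroupSum {ι : Type*} [Fintype ι] (q : ι → GammaSpace A) :
    booleanSubgroup (GammaSpace A) :=
  ⟨tupleSum (coeTuple q), sum_mem fun i _ => AddSubgroup.subset_closure ⟨q i, rfl⟩⟩

theorem continuous_subgroupSum {ι : Type*} [Fintype ι] :
    Continuous (subgroupSum A : (ι → GammaSpace A) → _) :=
  (continuous_tupleSum.comp (continuous_pi fun i =>
    OnePoint.continuous_coe.comp (continuous_apply i))).subtype_mk _

theorem exists_subgroupSum_eq (a : booleanSubgroup (GammaSpace A)) :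
    ∃ (n : ℕ) (q : Fin n → GammaSpace A), subgroupSum A q = a := by
  obtain ⟨n, q, hq⟩ := exists_tupleSum_eq _ a.2
  exact ⟨n, q, Subtype.ext hq⟩

/-- The endomorphism of the free Boolean group that replaces the point at infinity by a given
ordinal. -/
noncomputable def retractHom (w : CountableOrdinal) :
    FreeBooleanGroup (OnePoint (GammaSpace A)) →+ FreeBooleanGroup (OnePoint (GammaSpace A)) :=
  Finsupp.mapDomain.addMonoidHom fun z => (retract w z : OnePoint (GammaSpace A))

theorem retractHom_of (w : CountableOrdinal) (z : OnePoint (GammaSpace A)) :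
    retractHom w (of z) = of (retract w z : OnePoint (GammaSpace A)) :=
  Finsupp.mapDomain_single

theorem retractHom_tupleSum (w : CountableOrdinal) {ι : Type*} [Fintype ι]
    (p : ι → OnePoint (GammaSpace A)) :
    retractHom w (tupleSum p) = subgroupSum A (retract w ∘ p) := by
  simp only [tupleSum, map_sum, retractHom_of]
  rfl

theorem retractHom_coe (w : CountableOrdinal) (a : booleanSubgroup (GammaSpace A)) :
    retractHom w (a : FreeBooleanGroup (OnePoint (GammaSpace A))) = a := by
  obtain ⟨n, q, rfl⟩ := exists_subgroupSum_eq a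
  exact retractHom_tupleSum w (coeTuple q)

theorem of_injective {K : Type*} : Function.Injective (of : K → FreeBooleanGroup K) :=
  Finsupp.single_left_injective one_ne_zero

/-- Each `retractHom w` fixes the subgroup pointwise but moves `∞`. -/
theorem of_infty_notMem :
    of (OnePoint.infty : OnePoint (GammaSpace A)) ∉ booleanSubgroup (GammaSpace A) := fun h => by
  obtain ⟨w⟩ : Nonempty CountableOrdinal := inferInstance
  have := retractHom_coe w ⟨_, h⟩
  rw [retractHom_of, retract_infty] at this
  exact OnePoint.coe_ne_infty _ (of_injective this)

theorem t2Space_freeBooleanGroup (hA : IsMaximalChain A) :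
    T2Space (FreeBooleanGroup (OnePoint (GammaSpace A))) :=
  t2Space_of_clopen (exists_isClopen_onePoint hA)

/-- The topology of the subgroup generated by the space is determined by the images of the finite
powers of the space. -/
theorem isOpen_of_forall_isOpen_subgroupSum (hA : IsMaximalChain A)
    {U : Set (booleanSubgroup (GammaSpace A))}
    (hU : ∀ n, IsOpen ((subgroupSum A : (Fin n → GammaSpace A) → _) ⁻¹' U)) : IsOpen U := by
  have := locallyCompactSpace hA
  -- `V` is an open extension of `U`: on the subgroup `retractHom w` is the identity, so there the
  -- condition does not depend on `w`.
  let V : Set (FreeBooleanGroup (OnePoint (GammaSpace A))) :=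
    {a | ∀ᶠ w in atTop, retractHom w a ∈ Subtype.val '' U}
  have hV : IsOpen V := isOpen_of_forall_isOpen_tupleSum fun n => by
    convert isOpen_setOf_eventually_retract_mem hA (hU n) using 1
    ext p
    refine eventually_congr (Eventually.of_forall fun w => ?_)
    rw [retractHom_tupleSum, Subtype.val_injective.mem_set_image]
    rfl
  convert hV.preimage continuous_subtype_val using 1
  ext a
  simp only [V, mem_preimage, mem_ofPred_eq, retractHom_coe, Subtype.val_injective.mem_set_image,
    eventually_const]

theorem isClosed_of_forall_isClosed_subgroupSum (hA : IsMaximalChain A)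
    {S : Set (booleanSubgroup (GammaSpace A))}
    (hS : ∀ n, IsClosed ((subgroupSum A : (Fin n → GammaSpace A) → _) ⁻¹' S)) : IsClosed S := by
  rw [← isOpen_compl_iff]
  exact isOpen_of_forall_isOpen_subgroupSum hA fun n => (hS n).isOpen_compl

theorem sequentialSpace_booleanSubgroup (hA : IsMaximalChain A) :
    SequentialSpace (booleanSubgroup (GammaSpace A)) := by
  have := firstCountableTopology hA
  exact ⟨fun S hS => isClosed_of_forall_isClosed_subgroupSum hA fun n =>
    (hS.preimage continuous_subgroupSum.seqContinuous).isClosed⟩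

theorem isCOmegaSpace_booleanSubgroup (hA : IsMaximalChain A) :
    IsCOmegaSpace (booleanSubgroup (GammaSpace A)) := by
  have := firstCountableTopology hA
  have := countablyCompactSpace hA
  refine ⟨range fun n => range (subgroupSum A : (Fin n → GammaSpace A) → _), countable_range _, ?_,
    fun U => ⟨fun hU K _ => hU.preimage continuous_subtype_val, fun hU => ?_⟩⟩
  · rintro _ ⟨n, rfl⟩
    dsimp only
    rw [← image_univ]
    exact CountablyCompactSpace.isCountablyCompact_univ.image continuous_subgroupSum
  · refine isOpen_of_forall_isOpen_subgroupSum hA fun n => ?_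
    exact (hU _ ⟨n, rfl⟩).preimage
      (f := rangeFactorization (subgroupSum A : (Fin n → GammaSpace A) → _))
      (continuous_subgroupSum.subtype_mk _)

theorem separableSpace_booleanSubgroup (hA : IsMaximalChain A) :
    TopologicalSpace.SeparableSpace (booleanSubgroup (GammaSpace A)) := by
  have : TopologicalSpace.SeparableSpace (GammaSpace A) :=
    ⟨_, countable_range _, denseRange_nat hA⟩
  choose D hDc hDd using fun n : ℕ => TopologicalSpace.exists_countable_dense (Fin n → GammaSpace A)
  refine ⟨⋃ n, subgroupSum A '' D n, countable_iUnion fun n => (hDc n).image _, fun a => ?_⟩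
  obtain ⟨n, q, rfl⟩ := exists_subgroupSum_eq a
  exact closure_mono (subset_iUnion (fun n => subgroupSum A '' D n) n)
    (image_closure_subset_closure_image continuous_subgroupSum ⟨q, hDd n q, rfl⟩)

theorem t35Space_booleanSubgroup (hA : IsMaximalChain A) :
    T35Space (booleanSubgroup (GammaSpace A)) := by
  have := t2Space_freeBooleanGroup hA
  let _ := IsTopologicalAddGroup.rightUniformSpace (booleanSubgroup (GammaSpace A))
  exact {}

theorem not_isKOmegaSpace_booleanSubgroup (hA : IsMaximalChain A) :
    ¬ IsKOmegaSpace (booleanSubgroup (GammaSpace A)) := by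
  have := t2Space_freeBooleanGroup hA
  rintro ⟨𝒦, h𝒦, hcomp, hopen⟩
  let g : GammaSpace A → booleanSubgroup (GammaSpace A) := fun x =>
    ⟨of (x : OnePoint (GammaSpace A)), AddSubgroup.subset_closure ⟨x, rfl⟩⟩
  have hg : Continuous g := ((continuous_of _).comp OnePoint.continuous_coe).subtype_mk _
  have hginj : Function.Injective g := fun x y hxy =>
    OnePoint.coe_injective (of_injective (congrArg Subtype.val hxy))
  -- The image of `K` is closed and omits `∞`, the limit of the ordinals.
  have hev : ∀ K ∈ 𝒦, ∃ v, ∀ w ≥ v, g (ord w) ∉ K := by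
    intro K hK
    have hcl : IsClosed (of ⁻¹' (Subtype.val '' K) : Set (OnePoint (GammaSpace A))) :=
      ((hcomp K hK).image continuous_subtype_val).isClosed.preimage (continuous_of _)
    have hinf : OnePoint.infty ∉ (of ⁻¹' (Subtype.val '' K) : Set (OnePoint (GammaSpace A))) := by
      rintro ⟨a, -, ha⟩
      exact of_infty_notMem (ha ▸ a.2)
    refine eventually_atTop.1 ?_
    filter_upwards [tendsto_ord_infty.eventually (hcl.isOpen_compl.mem_nhds hinf)] with w hw hK
    exact hw ⟨_, hK, rfl⟩
  choose! v hv using hev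
  obtain ⟨w, hw⟩ := CountableOrdinal.exists_forall_lt (h𝒦.image v)
  refine not_isOpen_ord hA w ?_
  -- This point lies in no member of `𝒦`, so all its traces are empty.
  have h1 : IsOpen ({g (ord w)} : Set (booleanSubgroup (GammaSpace A))) := by
    rw [hopen]
    intro K hK
    have : (Subtype.val ⁻¹' {g (ord w)} : Set K) = ∅ := by
      refine eq_empty_of_forall_notMem ?_
      rintro ⟨x, hx⟩ rfl
      exact hv K hK w (hw _ ⟨K, hK, rfl⟩).le hx
    rw [this]
    exact isOpen_empty
  have h2 := h1.preimage hg
  rwa [← image_singleton, hginj.preimage_image] at h2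

end GammaSpace

theorem exists_isGammaN_of_towerNumber_eq (h : towerNumber = Cardinal.aleph 1) :
    ∃ (X : Type) (_ : TopologicalSpace X), IsGammaN X ∧ CountablyCompactSpace X ∧
      T35Space (booleanSubgroup X) ∧
      TopologicalSpace.SeparableSpace (booleanSubgroup X) ∧
      SequentialSpace (booleanSubgroup X) ∧
      IsCOmegaSpace (booleanSubgroup X) ∧ ¬ IsKOmegaSpace (booleanSubgroup X) := by
  obtain ⟨A, h1, h2, h3⟩ := exists_increasing_of_towerNumber_eq h
  have hA : IsMaximalChain A := ⟨h1, fun v w hvw => (h2 v w hvw).1, fun v w hvw => (h2 v w hvw).2, h3⟩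
  exact ⟨GammaSpace A, inferInstance, GammaSpace.isGammaN hA, GammaSpace.countablyCompactSpace hA,
    GammaSpace.t35Space_booleanSubgroup hA, GammaSpace.separableSpace_booleanSubgroup hA,
    GammaSpace.sequentialSpace_booleanSubgroup hA, GammaSpace.isCOmegaSpace_booleanSubgroup hA,
    GammaSpace.not_isKOmegaSpace_booleanSubgroup hA⟩

theorem mainTheorem8 :
    (¬ ExistsSeparableNonmetrizableFrechetGroup →
      ∃ (G : Type) (_ : Group G) (_ : TopologicalSpace G), IsTopologicalGroup G ∧ T35Space G ∧
        TopologicalSpace.SeparableSpace G ∧ SequentialSpace G ∧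
        IsCOmegaSpace G ∧ ¬ IsKOmegaSpace G) ∧
    (¬ ExistsSeparableNonmetrizableFrechetGroup → towerNumber = Cardinal.aleph 1) ∧
    (towerNumber = Cardinal.aleph 1 →
      ∃ (X : Type) (_ : TopologicalSpace X), IsGammaN X ∧ CountablyCompactSpace X ∧
        T35Space (booleanSubgroup X) ∧
        TopologicalSpace.SeparableSpace (booleanSubgroup X) ∧
        SequentialSpace (booleanSubgroup X) ∧
        IsCOmegaSpace (booleanSubgroup X) ∧ ¬ IsKOmegaSpace (booleanSubgroup X)) := by
  refine ⟨fun h => ?_, towerNumber_eq_of_not_exists, exists_isGammaN_of_towerNumber_eq⟩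
  obtain ⟨X, _, -, -, h1, h2, h3, h4, h5⟩ :=
    exists_isGammaN_of_towerNumber_eq (towerNumber_eq_of_not_exists h)
  exact ⟨Multiplicative (booleanSubgroup X), inferInstance, inferInstance, inferInstance,
    h1, h2, h3, h4, h5⟩
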